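/- All logarithms are to base $2$. Let $q\ge 4$ be even, $0<\epsilon\le 1/2$, and let $W$ be the typewriter channel with input and output alphabet $\mathbb{Z}_q$, $W(x|x)=1-\epsilon$, $W(x+1|x)=\epsilon$ (addition mod $q$), all other transition probabilities being $0$. Its reliability function is $$E(R)=\limsup_{n\to\infty}\frac1n\log\frac{1}{\mathsf P_e(\lceil 2^{nR}\rceil,n)},$$ where $\mathsf P_e(M,n)$ is the smallest probability of error (average or maximal over the codewords; the claims below hold for either choice) of codes with $M$ codewords of length $n$, and the exponent is $+\infty$ where $\mathsf P_e=0$. Put $\alpha=\sqrt{\epsilon(1-\epsilon)}$, $h_2(x)=-x\log x-(1-x)\log(1-x)$, let $\delta_{GV}(r)\in[0,1/2]$ be defined for $0\le r\le 1$ by $r=1-h_2(\delta_{GV}(r))$, let $R^*=1-h_2\!\left(\frac{2\alpha}{1+2\alpha}\right)$, and let $$E_{\rm ex}^{\rm BSC}(r)=\begin{cases}\log\frac{2}{1+2\alpha}-r, & r\ge R^*,\\ -\delta_{GV}(r)\log(2\alpha), & 0\le r\le R^*,\end{cases}$$ be the expurgated exponent of the binary symmetric channel with crossover probability $\epsilon$.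 (1) For every $R>\log(q/2)$, $$E(R)\ \ge\ E_{\rm ex}^{\rm BSC}\bigl(R-\log(q/2)\bigr).$$ (2) Let $\log(q/2)<R\le\log q$ and $r=R-\log(q/2)$. There are binary linear codes $C_{2,n}\subseteq\{0,1\}^n$ with $\frac1n\dim C_{2,n}\to r$ such that, for $1\le z\le n$, the number $B_z$ of words of $C_{2,n}$ of Hamming weight $z$ is $0$ if $z<\delta_{GV}(r)\,n$ and is always at most $2^{n(r-1+h_2(z/n)+o(1))}$, with $o(1)$ uniform in $z$, and such that the codes $C_n=\{0,2,\dots,q-2\}^n+C_{2,n}\subseteq\mathbb{Z}_q^n$ satisfy $\frac1n\log|C_n|\to R$ and, for the maximal error probability $P_e(C_n)$ of $C_n$ under its best decoder, $\liminf_{n}\frac1n\log\frac1{P_e(C_n)}\ge E_{\rm ex}^{\rm BSC}(r)$. (3) Let $E_{\rm ex}^\infty(R)=\sup_{k\ge1}\sup_{\rho\ge1}\bigl[-\frac{\rho}{k}\log\min_{P}\sum_{x,x'\in\mathbb{Z}_q^k}P(x)P(x')g_k(x,x')^{1/\rho}-\rho R\bigr]$ be the multiletter expurgated exponent of $W$,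 where $P$ runs over the probability distributions on $\mathbb{Z}_q^k$ and $g_k(x,x')=\sum_{y}\sqrt{W^k(y|x)W^k(y|x')}$. If $\epsilon<1/2$, then $R^*>0$ and $$E_{\rm ex}^\infty(R)<E_{\rm ex}^{\rm BSC}\bigl(R-\log(q/2)\bigr)\qquad\text{for } \log(q/2)<R<\log(q/2)+R^*.$$ Moreover, if $\epsilon<1/2$, it is false that $E(R)=E_{\rm ex}^\infty(R)$ for all positive rates $R$ below the critical rate $R_{\rm crit}=\log q-h_2\!\left(\frac{\sqrt\epsilon}{\sqrt\epsilon+\sqrt{1-\epsilon}}\right)$; in particular the Shannon–Gallager–Berlekamp conjecture fails for $q=4$. -/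

import Mathlib

open Filter Topology

noncomputable section

namespace Typewriter

/-! Discrete memoryless channels. `W x y` is the probability of output `y` given input `x`. -/

section Channel

variable {X Y : Type} [Fintype X] [Fintype Y]

/-- The `n`-fold memoryless extension of a channel. -/
def memoryless (W : X → Y → ℝ) (n : ℕ) (x : Fin n → X) (y : Fin n → Y) : ℝ :=
  ∏ i, W (x i) (y i)

/-- Probability that the decoder `dec` does not return `m` when the codeword of `m` is sent. -/
def errorGiven (W : X → Y → ℝ) {n : ℕ} {ι : Type} [DecidableEq ι]
    (enc : ι → Fin n → X) (dec : (Fin n → Y) → ι) (m : ι) : ℝ :=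
  ∑ y, if dec y = m then 0 else memoryless W n (enc m) y

/-- Average probability of error of a code, with the best decoder for it. -/
def avgError (W : X → Y → ℝ) {n : ℕ} {ι : Type} [Fintype ι] [DecidableEq ι]
    (enc : ι → Fin n → X) : ℝ :=
  ⨅ dec : (Fin n → Y) → ι, (∑ m, errorGiven W enc dec m) / (Fintype.card ι : ℝ)

/-- Maximal probability of error of a code, with the best decoder for it. -/
def maxError (W : X → Y → ℝ) {n : ℕ} {ι : Type} [DecidableEq ι]
    (enc : ι → Fin n → X) : ℝ :=
  ⨅ dec : (Fin n → Y) → ι, ⨆ m, errorGiven W enc dec m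

/-- Smallest average probability of error of codes with `M` codewords of length `n`. -/
def optAvgError (W : X → Y → ℝ) (M n : ℕ) : ℝ :=
  ⨅ enc : Fin M → Fin n → X, avgError W enc

/-- Smallest maximal probability of error of codes with `M` codewords of length `n`. -/
def optMaxError (W : X → Y → ℝ) (M n : ℕ) : ℝ :=
  ⨅ enc : Fin M → Fin n → X, maxError W enc

/-- `(1/n) log₂ (1/p)`, with value `∞` at `p = 0`. -/
def expo (n : ℕ) (p : ℝ) : EReal :=
  if p = 0 then ⊤ else ((1 / (n : ℝ) * Real.logb 2 (1 / p) : ℝ) : EReal)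

/-- The reliability function at rate `R` (bits per channel use), for the average error. -/
def reliabilityAvg (W : X → Y → ℝ) (R : ℝ) : EReal :=
  limsup (fun n : ℕ => expo n (optAvgError W ⌈(2 : ℝ) ^ ((n : ℝ) * R)⌉₊ n)) atTop

/-- The reliability function at rate `R` (bits per channel use), for the maximal error. -/
def reliabilityMax (W : X → Y → ℝ) (R : ℝ) : EReal :=
  limsup (fun n : ℕ => expo n (optMaxError W ⌈(2 : ℝ) ^ ((n : ℝ) * R)⌉₊ n)) atTop

/-- The Bhattacharyya coefficient `g_k(x₁, x₂)`. -/
def bhatt (W : X → Y → ℝ) (k : ℕ) (x₁ x₂ : Fin k → X) : ℝ :=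
  ∑ y, Real.sqrt (memoryless W k x₁ y * memoryless W k x₂ y)

/-- The quadratic form `Q^k(ρ, P)`. -/
def quadForm (W : X → Y → ℝ) (k : ℕ) (ρ : ℝ) (P : (Fin k → X) → ℝ) : ℝ :=
  ∑ x₁, ∑ x₂, P x₁ * P x₂ * bhatt W k x₁ x₂ ^ (1 / ρ)

/-- `E_x^k(ρ)`; the minimum is over all probability distributions on `X^k`. -/
def expurgatedX (W : X → Y → ℝ) (k : ℕ) (ρ : ℝ) : ℝ :=
  -(ρ / k) * Real.logb 2 (sInf (quadForm W k ρ '' stdSimplex ℝ (Fin k → X)))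

/-- The `k`-letter expurgated exponent `E_ex^k(R)`. -/
def expurgated (W : X → Y → ℝ) (k : ℕ) (R : ℝ) : EReal :=
  ⨆ ρ : {ρ : ℝ // 1 ≤ ρ}, ((expurgatedX W k ρ - ρ * R : ℝ) : EReal)

/-- The multiletter expurgated exponent `E_ex^∞(R)`. -/
def expurgatedInf (W : X → Y → ℝ) (R : ℝ) : EReal :=
  ⨆ k : {k : ℕ // 1 ≤ k}, expurgated W k R

end Channel

/-- The typewriter channel on `ℤ/q` with crossover probability `ε`. -/
def typewriter (q : ℕ) (ε : ℝ) (x y : ZMod q) : ℝ :=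
  if y = x then 1 - ε else if y = x + 1 then ε else 0

/-- Binary entropy in bits. -/
def h2 (x : ℝ) : ℝ := -x * Real.logb 2 x - (1 - x) * Real.logb 2 (1 - x)

/-- `α_ε = √(ε(1-ε))`. -/
def alpha (ε : ℝ) : ℝ := Real.sqrt (ε * (1 - ε))

/-- The Gilbert–Varshamov relative distance for binary codes: for `0 ≤ r ≤ 1` the set below has
exactly one element, so this is the `δ ∈ [0, 1/2]` with `r = 1 - h₂(δ)`. -/
def deltaGV (r : ℝ) : ℝ := sInf {δ | δ ∈ Set.Icc (0 : ℝ) (1 / 2) ∧ r = 1 - h2 δ}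

/-- The rate at which the expurgated exponent of the BSC leaves its straight line. -/
def rateExBSC (ε : ℝ) : ℝ := 1 - h2 (2 * alpha ε / (1 + 2 * alpha ε))

/-- The expurgated exponent of the binary symmetric channel. -/
def expurgatedBSC (ε r : ℝ) : ℝ :=
  if rateExBSC ε ≤ r then Real.logb 2 (2 / (1 + 2 * alpha ε)) - r
  else -deltaGV r * Real.logb 2 (2 * alpha ε)

/-- The critical rate of the typewriter channel. -/
def rateCrit (q : ℕ) (ε : ℝ) : ℝ :=
  Real.logb 2 q - h2 (Real.sqrt ε / (Real.sqrt ε + Real.sqrt (1 - ε)))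

/-- The zero-error code `{0, 2, …, q-2}^n` in `(ℤ/q)^n`. -/
def zeroErrorCode (q n : ℕ) : Set (Fin n → ZMod q) := {a | ∀ i, ∃ j < q / 2, a i = (2 * j : ℕ)}

/-- A binary word read as a word in `{0, 1}^n ⊆ (ℤ/q)^n`. -/
def liftWord (q : ℕ) {n : ℕ} (b : Fin n → ZMod 2) : Fin n → ZMod q := fun i => ((b i).val : ZMod q)

open Classical in
/-- The union of the cosets `C⁰ + b` of the zero-error code, for `b` in the binary code `C₂`. -/
def cosetCode (q : ℕ) [NeZero q] {n : ℕ} (C₂ : Submodule (ZMod 2) (Fin n → ZMod 2)) :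
    Finset (Fin n → ZMod q) :=
  Finset.univ.filter fun x => ∃ a ∈ zeroErrorCode q n, ∃ b ∈ C₂, x = a + liftWord q b

/-- The number of codewords of Hamming weight `z` in a binary linear code. -/
def weightCount {n : ℕ} (C₂ : Submodule (ZMod 2) (Fin n → ZMod 2)) (z : ℕ) : ℕ :=
  Set.ncard {b | b ∈ C₂ ∧ hammingNorm b = z}

/-- Gilbert–Varshamov-type spectrum at rate `r`: no nonzero codeword of relative weight below
`δ_GV(r)`, and at most `2^{n(r - 1 + h₂(z/n) + o(1))}` codewords of weight `z`, uniformly in `z`. -/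
def HasGVSpectrum (r : ℝ) (C₂ : ∀ n : ℕ, Submodule (ZMod 2) (Fin n → ZMod 2)) : Prop :=
  ∃ η : ℕ → ℝ, Tendsto η atTop (𝓝 0) ∧ ∀ n z : ℕ, 1 ≤ z → z ≤ n →
    ((z : ℝ) < deltaGV r * n → weightCount (C₂ n) z = 0) ∧
    (weightCount (C₂ n) z : ℝ) ≤ (2 : ℝ) ^ ((n : ℝ) * (r - 1 + h2 ((z : ℝ) / n) + η n))

end Typewriter

end

/-!
Parity splits `(ℤ/q)^n`, `q` even, into the cosets of the zero-error code `{0, 2, …, q-2}^n`. The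
Bhattacharyya coefficients of the typewriter channel are products of the kernel on the `q`-cycle
with weight `1` at distance `0` and `α` at distance `1`, so a codeword receives total weight
`(2α)^|b|` from the coset at parity difference `b`. As `2α` is the Bhattacharyya coefficient of the
BSC, the union bound for a union of cosets is the one for a binary linear code on the BSC. A code
with at most the random-coding average number of words of each weight, hence none below the
Gilbert–Varshamov distance, brings it down to `2^{-n(E_ex(r) - o(1))}`.

On the other side, if `0 ≤ β ≤ 1/2` and `β ≤ α^{1/ρ}`, then the cycle kernel of weight `β` is
positive semidefinite and lies below the `1/ρ`-th power of the kernel of weight `α`. The uniform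
distribution minimizes the quadratic form of every tensor power of a positive semidefinite kernel
with constant row sums, so `E_x^k(ρ) ≤ ρ (log q - log (1 + 2β))` for all `k`. Below the rate `R*`
Gibbs' inequality at `δ_GV(r)` shows that the resulting exponent is smaller than `E_ex(r)`.
-/

noncomputable section

namespace Typewriter

lemma logb_two_div {x : ℝ} (hx : x ≠ 0) : Real.logb 2 (2 / x) = 1 - Real.logb 2 x := by
  rw [Real.logb_div two_ne_zero hx, Real.logb_self_eq_one one_lt_two]

lemma logb_div_two {x : ℝ} (hx : x ≠ 0) : Real.logb 2 (x / 2) = Real.logb 2 x - 1 := by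
  rw [Real.logb_div hx two_ne_zero, Real.logb_self_eq_one one_lt_two]

lemma logb_two_mul {x : ℝ} (hx : x ≠ 0) : Real.logb 2 (2 * x) = 1 + Real.logb 2 x := by
  rw [Real.logb_mul two_ne_zero hx, Real.logb_self_eq_one one_lt_two]

lemma h2_eq_binEntropy_div (x : ℝ) : h2 x = Real.binEntropy x / Real.log 2 := by
  simp only [h2, Real.binEntropy, Real.logb, Real.log_inv]
  ring

lemma continuous_h2 : Continuous h2 := by
  rw [funext h2_eq_binEntropy_div]
  fun_prop

lemma strictMonoOn_h2 : StrictMonoOn h2 (Set.Icc 0 (1 / 2)) := by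
  intro a ha b hb hab
  rw [one_div] at ha hb
  rw [h2_eq_binEntropy_div, h2_eq_binEntropy_div]
  exact div_lt_div_of_pos_right (Real.binEntropy_strictMonoOn ha hb hab) (Real.log_pos one_lt_two)

lemma h2_zero : h2 0 = 0 := by simp [h2]

lemma h2_one_half : h2 (1 / 2) = 1 := by
  rw [h2_eq_binEntropy_div, one_div, Real.binEntropy_two_inv,
    div_self (Real.log_pos one_lt_two).ne']

lemma h2_nonneg {x : ℝ} (h0 : 0 ≤ x) (h1 : x ≤ 1) : 0 ≤ h2 x := by
  rw [h2_eq_binEntropy_div]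
  exact div_nonneg (Real.binEntropy_nonneg h0 h1) (Real.log_nonneg one_le_two)

lemma h2_lt_one {x : ℝ} (hx : x ≠ 1 / 2) : h2 x < 1 := by
  rw [h2_eq_binEntropy_div, div_lt_one (Real.log_pos one_lt_two)]
  exact Real.binEntropy_lt_log_two.2 (by rwa [← one_div])

-- Gibbs' inequality against the two-point distribution with odds `x`.
lemma h2_add_mul_logb_lt {t x : ℝ} (h0 : 0 ≤ t) (h1 : t ≤ 1) (hx : 0 < x)
    (hne : t ≠ x / (1 + x)) : h2 t + t * Real.logb 2 x < Real.logb 2 (1 + x) := by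
  rw [h2_eq_binEntropy_div, Real.logb, Real.logb, ← mul_div_assoc, ← add_div]
  refine div_lt_div_of_pos_right ?_ (Real.log_pos one_lt_two)
  rcases h0.eq_or_lt with rfl | h0
  · simpa using Real.log_pos (by linarith : 1 < 1 + x)
  rcases h1.eq_or_lt with rfl | h1
  · simpa using Real.log_lt_log hx (by linarith)
  have h1' : 0 < 1 - t := by linarith
  have ratios_ne : x / t ≠ 1 / (1 - t) := by
    rw [Ne, div_eq_div_iff h0.ne' h1'.ne']
    intro h
    exact hne (by rw [eq_div_iff (by linarith)]; linarith)
  have jensen := strictConcaveOn_log_Ioi.2 (Set.mem_Ioi.2 (div_pos hx h0))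
    (Set.mem_Ioi.2 (div_pos one_pos h1')) ratios_ne h0 h1' (by ring)
  rw [smul_eq_mul, smul_eq_mul, smul_eq_mul, smul_eq_mul, mul_div_cancel₀ _ h0.ne',
    mul_div_cancel₀ _ h1'.ne', Real.log_div hx.ne' h0.ne', one_div, Real.log_inv,
    add_comm x] at jensen
  simp only [Real.binEntropy, Real.log_inv]
  linarith

lemma h2_div_one_add {x : ℝ} (hx : 0 < x) :
    h2 (x / (1 + x)) + x / (1 + x) * Real.logb 2 x = Real.logb 2 (1 + x) := by
  have hx' : 1 + x ≠ 0 := by positivity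
  rw [h2, show 1 - x / (1 + x) = (1 + x)⁻¹ by field_simp; ring, Real.logb_div hx.ne' hx',
    Real.logb_inv]
  field_simp
  ring

lemma h2_add_mul_logb_le {t x : ℝ} (h0 : 0 ≤ t) (h1 : t ≤ 1) (hx : 0 < x) :
    h2 t + t * Real.logb 2 x ≤ Real.logb 2 (1 + x) := by
  by_cases h : t = x / (1 + x)
  · rw [h, h2_div_one_add hx]
  · exact (h2_add_mul_logb_lt h0 h1 hx h).le

lemma strictAntiOn_h2_add_mul_logb {x : ℝ} (hx : 0 < x) :
    StrictAntiOn (fun t => h2 t + t * Real.logb 2 x) (Set.Icc (x / (1 + x)) 1) := by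
  rintro s ⟨hs, -⟩ t ⟨-, ht⟩ hst
  have hs0 : 0 < s := (by positivity : 0 < x / (1 + x)).trans_le hs
  have hs1 : 0 < 1 - s := by linarith
  set y := s / (1 - s) with hy
  have hy0 : 0 < y := div_pos hs0 hs1
  have hsy : y / (1 + y) = s := by rw [hy]; field_simp; ring
  have hxy : Real.logb 2 x ≤ Real.logb 2 y := by
    refine Real.logb_le_logb_of_le one_lt_two hx ?_
    rw [div_le_iff₀ (by positivity)] at hs
    rw [hy, le_div_iff₀ hs1]
    linarith
  have gibbs := h2_add_mul_logb_lt (hs0.trans hst).le ht hy0 (by rw [hsy]; exact hst.ne')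
  rw [← h2_div_one_add hy0, hsy] at gibbs
  change h2 t + t * Real.logb 2 x < h2 s + s * Real.logb 2 x
  nlinarith [mul_le_mul_of_nonneg_left hxy (sub_nonneg.2 hst.le)]

lemma deltaGV_nonneg (r : ℝ) : 0 ≤ deltaGV r := Real.sInf_nonneg fun _ h => h.1.1

lemma deltaGV_spec {r : ℝ} (h0 : 0 ≤ r) (h1 : r ≤ 1) :
    deltaGV r ≤ 1 / 2 ∧ h2 (deltaGV r) = 1 - r := by
  obtain ⟨d, hd, hdr⟩ : 1 - r ∈ h2 '' Set.Icc 0 (1 / 2) := by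
    refine intermediate_value_Icc (by norm_num) continuous_h2.continuousOn ?_
    rw [h2_zero, h2_one_half]
    constructor <;> linarith
  have hsingle : {δ | δ ∈ Set.Icc (0 : ℝ) (1 / 2) ∧ r = 1 - h2 δ} = {d} := by
    ext e
    constructor
    · rintro ⟨he, her⟩
      exact strictMonoOn_h2.injOn he hd (by linarith)
    · rintro rfl
      exact ⟨hd, by linarith⟩
  rw [deltaGV, hsingle, csInf_singleton]
  exact ⟨hd.2, hdr⟩

lemma lt_deltaGV_iff {r d : ℝ} (h0 : 0 ≤ r) (h1 : r ≤ 1) (hd : d ∈ Set.Icc (0 : ℝ) (1 / 2)) :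
    d < deltaGV r ↔ h2 d < 1 - r := by
  obtain ⟨hle, heq⟩ := deltaGV_spec h0 h1
  rw [← heq, strictMonoOn_h2.lt_iff_lt hd ⟨deltaGV_nonneg r, hle⟩]

lemma lowerSemicontinuousWithinAt_deltaGV {r : ℝ} (h0 : 0 ≤ r) (h1 : r ≤ 1) :
    LowerSemicontinuousWithinAt deltaGV (Set.Ioi r) r := by
  intro d hd
  rcases lt_or_ge d 0 with hneg | hnonneg
  · exact Eventually.of_forall fun r' => hneg.trans_le (deltaGV_nonneg r')
  have hdI : d ∈ Set.Icc (0 : ℝ) (1 / 2) := ⟨hnonneg, hd.le.trans (deltaGV_spec h0 h1).1⟩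
  have hlt : r < 1 - h2 d := by linarith [(lt_deltaGV_iff h0 h1 hdI).1 hd]
  filter_upwards [Ioo_mem_nhdsGT hlt] with r' hr'
  have hd1 : 0 ≤ h2 d := h2_nonneg hnonneg (by linarith [hdI.2])
  exact (lt_deltaGV_iff (h0.trans hr'.1.le) (by linarith [hr'.2]) hdI).2 (by linarith [hr'.2])

lemma alpha_pos {ε : ℝ} (h0 : 0 < ε) (h1 : ε < 1) : 0 < alpha ε :=
  Real.sqrt_pos.2 (mul_pos h0 (sub_pos.2 h1))

lemma alpha_nonneg (ε : ℝ) : 0 ≤ alpha ε := Real.sqrt_nonneg _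

lemma alpha_le_half (ε : ℝ) : alpha ε ≤ 1 / 2 :=
  Real.sqrt_le_iff.2 ⟨by norm_num, by nlinarith [sq_nonneg (ε - 1 / 2)]⟩

lemma alpha_lt_half {ε : ℝ} (hne : ε ≠ 1 / 2) : alpha ε < 1 / 2 :=
  (Real.sqrt_lt' (by norm_num)).2 (by nlinarith [sq_pos_of_ne_zero (sub_ne_zero.2 hne)])

lemma two_alpha_div_mem_Icc (ε : ℝ) :
    2 * alpha ε / (1 + 2 * alpha ε) ∈ Set.Icc (0 : ℝ) (1 / 2) := by
  have hα := alpha_nonneg ε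
  refine ⟨by positivity, ?_⟩
  rw [div_le_div_iff₀ (by positivity) two_pos]
  linarith [alpha_le_half ε]

lemma rateExBSC_le_one (ε : ℝ) : rateExBSC ε ≤ 1 := by
  have h := two_alpha_div_mem_Icc ε
  exact sub_le_self _ (h2_nonneg h.1 (by linarith [h.2]))

lemma rateExBSC_pos {ε : ℝ} (hne : ε ≠ 1 / 2) : 0 < rateExBSC ε := by
  have hα := alpha_nonneg ε
  refine sub_pos.2 (h2_lt_one (ne_of_lt ?_))
  rw [div_lt_div_iff₀ (by positivity) two_pos]
  linarith [alpha_lt_half hne]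

lemma two_alpha_div_lt_deltaGV {ε r : ℝ} (h0 : 0 ≤ r) (hr : r < rateExBSC ε) :
    2 * alpha ε / (1 + 2 * alpha ε) < deltaGV r :=
  (lt_deltaGV_iff h0 (hr.le.trans (rateExBSC_le_one ε)) (two_alpha_div_mem_Icc ε)).2
    (lt_sub_comm.1 hr)

lemma logb_two_alpha_nonpos (ε : ℝ) : Real.logb 2 (2 * alpha ε) ≤ 0 :=
  Real.logb_nonpos one_lt_two (by linarith [alpha_nonneg ε]) (by linarith [alpha_le_half ε])

lemma neg_expurgatedBSC_of_lt {ε r : ℝ} (h0 : 0 ≤ r) (hr : r < rateExBSC ε) :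
    -expurgatedBSC ε r =
      r - 1 + (h2 (deltaGV r) + deltaGV r * Real.logb 2 (2 * alpha ε)) := by
  rw [expurgatedBSC, if_neg hr.not_ge, (deltaGV_spec h0 (hr.le.trans (rateExBSC_le_one ε))).2]
  ring

lemma expurgatedBSC_of_le {ε r : ℝ} (hr : rateExBSC ε ≤ r) :
    expurgatedBSC ε r = 1 - Real.logb 2 (1 + 2 * alpha ε) - r := by
  rw [expurgatedBSC, if_pos hr, logb_two_div (by linarith [alpha_nonneg ε])]

-- A word of relative weight `t` contributes `(2α)^{nt}` to the union bound, and the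
-- Gilbert–Varshamov spectrum has `2^{n(r - 1 + h₂(t))}` of them.
lemma spectrum_exponent_le {ε r t : ℝ} (hε0 : 0 < ε) (hε1 : ε < 1) (h0 : 0 ≤ r)
    (ht : deltaGV r ≤ t) (ht1 : t ≤ 1) :
    r - 1 + (h2 t + t * Real.logb 2 (2 * alpha ε)) ≤ -expurgatedBSC ε r := by
  have hα : 0 < 2 * alpha ε := mul_pos two_pos (alpha_pos hε0 hε1)
  rcases le_or_gt (rateExBSC ε) r with hr | hr
  · rw [expurgatedBSC_of_le hr]
    linarith [h2_add_mul_logb_le ((deltaGV_nonneg r).trans ht) ht1 hα]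
  · rw [neg_expurgatedBSC_of_lt h0 hr]
    have hlt := two_alpha_div_lt_deltaGV h0 hr
    exact add_le_add_right ((strictAntiOn_h2_add_mul_logb hα).antitoneOn
      ⟨hlt.le, ht.trans ht1⟩ ⟨hlt.le.trans ht, ht1⟩ ht) _

lemma expurgatedBSC_nonpos (ε : ℝ) {r : ℝ} (hr : 1 ≤ r) : expurgatedBSC ε r ≤ 0 := by
  rw [expurgatedBSC_of_le ((rateExBSC_le_one ε).trans hr)]
  linarith [Real.logb_nonneg one_lt_two (by linarith [alpha_nonneg ε] : 1 ≤ 1 + 2 * alpha ε)]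

lemma lowerSemicontinuousWithinAt_expurgatedBSC (ε : ℝ) {r : ℝ} (h0 : 0 ≤ r) :
    LowerSemicontinuousWithinAt (expurgatedBSC ε) (Set.Ioi r) r := by
  intro c hc
  rcases le_or_gt (rateExBSC ε) r with hr | hr
  · rw [expurgatedBSC_of_le hr] at hc
    filter_upwards [Ioo_mem_nhdsGT (lt_sub_comm.1 hc)] with r' hr'
    rw [expurgatedBSC_of_le (hr.trans hr'.1.le)]
    exact lt_sub_comm.1 hr'.2
  · rw [expurgatedBSC, if_neg hr.not_ge] at hc
    have hlin : ∀ᶠ d in 𝓝[<] deltaGV r, c < -d * Real.logb 2 (2 * alpha ε) :=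
      ((by fun_prop : Continuous fun d : ℝ => -d * Real.logb 2 (2 * alpha ε)).tendsto
        (deltaGV r)).mono_left nhdsWithin_le_nhds |>.eventually (lt_mem_nhds hc)
    obtain ⟨d, hcd, hd⟩ := (hlin.and self_mem_nhdsWithin).exists
    filter_upwards [lowerSemicontinuousWithinAt_deltaGV h0 (hr.le.trans (rateExBSC_le_one ε)) d hd,
      Ioo_mem_nhdsGT hr] with r' hdr' hr'
    rw [expurgatedBSC, if_neg hr'.2.not_ge]
    nlinarith [logb_two_alpha_nonpos ε]

-- Gibbs' inequality at `t` bounds the left-hand side by a function affine in `ρ` with slope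
-- `1 - r - h₂(t) - t ≤ 0`, hence by its value at `ρ = 1`.
lemma mul_one_sub_logb_le {a r t ρ : ℝ} (ha : 0 < a) (ht0 : 0 ≤ t) (ht1 : t ≤ 1) (hρ : 1 ≤ ρ)
    (ht : 1 - r ≤ h2 t + t) :
    ρ * (1 - r - Real.logb 2 (1 + 2 * a ^ (1 / ρ))) ≤
      1 - r - (h2 t + t * Real.logb 2 (2 * a)) := by
  have : 0 < ρ := one_pos.trans_le hρ
  have gibbs := h2_add_mul_logb_le ht0 ht1 (by positivity : 0 < 2 * a ^ (1 / ρ))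
  rw [logb_two_mul (by positivity), Real.logb_rpow_eq_mul_logb_of_pos ha] at gibbs
  rw [logb_two_mul ha.ne']
  calc ρ * (1 - r - Real.logb 2 (1 + 2 * a ^ (1 / ρ)))
      ≤ ρ * (1 - r - (h2 t + t * (1 + 1 / ρ * Real.logb 2 a))) := by gcongr
    _ = ρ * (1 - r - (h2 t + t)) - t * Real.logb 2 a := by field_simp; ring
    _ ≤ 1 * (1 - r - (h2 t + t)) - t * Real.logb 2 a := by
      gcongr ?_ - _
      exact mul_le_mul_of_nonpos_right hρ (by linarith)
    _ = 1 - r - (h2 t + t * (1 + Real.logb 2 a)) := by ring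

lemma exists_mem_Ioo_deltaGV {r x : ℝ} (h0 : 0 ≤ r) (h1 : r ≤ 1) (hx0 : 0 ≤ x)
    (hx : x < deltaGV r) : ∃ t ∈ Set.Ioo x (deltaGV r), 1 - r < h2 t + t := by
  have hlt : 1 - r < h2 (deltaGV r) + deltaGV r := by
    rw [(deltaGV_spec h0 h1).2]
    linarith
  have hev : ∀ᶠ t in 𝓝[<] deltaGV r, 1 - r < h2 t + t :=
    ((continuous_h2.add continuous_id).tendsto _).mono_left nhdsWithin_le_nhds
      |>.eventually (lt_mem_nhds hlt)
  exact ((Filter.eventually_mem_set.2 (Ioo_mem_nhdsLT hx)).and hev).exists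

lemma exists_lt_expurgatedBSC {ε r : ℝ} (hε0 : 0 < ε) (hε1 : ε < 1) (hne : ε ≠ 1 / 2)
    (h0 : 0 ≤ r) (hr : r < rateExBSC ε) :
    ∃ B < expurgatedBSC ε r, ∀ ρ ≥ 1, ∃ β ∈ Set.Icc (0 : ℝ) (1 / 2),
      β ≤ alpha ε ^ (1 / ρ) ∧ ρ * (1 - r - Real.logb 2 (1 + 2 * β)) ≤ B := by
  have hα := alpha_pos hε0 hε1
  have h2α : 0 < 2 * alpha ε := mul_pos two_pos hα
  have h1 := hr.le.trans (rateExBSC_le_one ε)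
  have hδ := two_alpha_div_lt_deltaGV h0 hr
  have hx0 := (two_alpha_div_mem_Icc ε).1
  have hδ1 := (deltaGV_spec h0 h1).1
  obtain ⟨t, ⟨htα, htδ⟩, ht⟩ := exists_mem_Ioo_deltaGV h0 h1 hx0 hδ
  have hE : 0 < expurgatedBSC ε r := by
    rw [expurgatedBSC, if_neg hr.not_ge]
    exact mul_pos_of_neg_of_neg (by linarith)
      (Real.logb_neg one_lt_two h2α (by linarith [alpha_lt_half hne]))
  have hB : 1 - r - (h2 t + t * Real.logb 2 (2 * alpha ε)) < expurgatedBSC ε r := by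
    have := strictAntiOn_h2_add_mul_logb h2α ⟨htα.le, by linarith⟩ ⟨hδ.le, by linarith⟩ htδ
    linarith [neg_expurgatedBSC_of_lt h0 hr]
  refine ⟨_, max_lt hB hE, fun ρ hρ => ?_⟩
  rcases le_total (alpha ε ^ (1 / ρ)) (1 / 2) with hle | hge
  · exact ⟨_, ⟨by positivity, hle⟩, le_rfl,
      le_max_of_le_left (mul_one_sub_logb_le hα (hx0.trans htα.le) (by linarith) hρ ht.le)⟩
  · refine ⟨1 / 2, ⟨by norm_num, le_rfl⟩, hge, le_max_of_le_right ?_⟩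
    rw [show (1 : ℝ) + 2 * (1 / 2) = 2 by norm_num, Real.logb_self_eq_one one_lt_two]
    exact mul_nonpos_of_nonneg_of_nonpos (by linarith) (by linarith)

section LinearCode

variable {F V : Type*} [Field F] [AddCommGroup V] [Module F V]

lemma exists_linearEquiv_apply_eq {c c' : V} (hc : c ≠ 0) (hc' : c' ≠ 0) :
    ∃ g : V ≃ₗ[F] V, g c = c' := by
  obtain ⟨g, hg⟩ := Submodule.exists_linearEquiv_restrict_eq
    (LinearEquiv.coord F V c hc ≪≫ₗ LinearEquiv.toSpanNonzeroSingleton F V c' hc')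
  refine ⟨g, ?_⟩
  rw [← hg ⟨c, Submodule.mem_span_singleton_self c⟩, LinearEquiv.trans_apply,
    LinearEquiv.coord_self, LinearEquiv.toSpanNonzeroSingleton_one]

lemma exists_submodule_finrank_eq {k : ℕ} (hk : k ≤ Module.finrank F V) :
    ∃ C : Submodule F V, Module.finrank F C = k := by
  obtain ⟨v, hv⟩ := exists_linearIndependent_of_le_finrank hk
  exact ⟨Submodule.span F (Set.range v), (finrank_span_eq_card hv).trans (Fintype.card_fin k)⟩

lemma exists_sum_linearEquiv_eq [Fintype (V ≃ₗ[F] V)] (w : V → ℝ) :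
    ∃ a, ∀ b, b ≠ 0 → ∑ g : V ≃ₗ[F] V, w (g b) = a := by
  rcases subsingleton_or_nontrivial V with hV | hV
  · exact ⟨0, fun b hb => absurd (Subsingleton.elim b 0) hb⟩
  obtain ⟨c, hc⟩ := exists_ne (0 : V)
  refine ⟨∑ g : V ≃ₗ[F] V, w (g c), fun b hb => ?_⟩
  obtain ⟨f, rfl⟩ := exists_linearEquiv_apply_eq (F := F) hc hb
  exact Fintype.sum_equiv (Equiv.mulRight f) _ _ fun g => rfl

variable [Fintype V]

open Classical in
/-- The total weight of the nonzero words of the linear code `C`. For `w b = x ^ hammingNorm b` it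
is the weight enumerator of `C` at `x` without its constant term. -/
def nonzeroSum (w : V → ℝ) (C : Submodule F V) : ℝ := ∑ b with b ∈ C ∧ b ≠ 0, w b

lemma nonzeroSum_map (w : V → ℝ) (C : Submodule F V) (g : V ≃ₗ[F] V) :
    nonzeroSum w (C.map (g : V →ₗ[F] V)) = nonzeroSum (fun b => w (g b)) C := by
  symm
  exact Finset.sum_equiv g.toEquiv (by simp) fun _ _ => rfl

lemma nonzeroSum_mono {w : V → ℝ} (hw : ∀ b, 0 ≤ w b) {C D : Submodule F V} (h : C ≤ D) :
    nonzeroSum w C ≤ nonzeroSum w D := by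
  classical
  exact Finset.sum_le_sum_of_subset_of_nonneg
    (Finset.monotone_filter_right _ fun _ _ hb => ⟨h hb.1, hb.2⟩) fun b _ _ => hw b

open Classical in
lemma nonzeroSum_eq_sum_sub (w : V → ℝ) (C : Submodule F V) :
    nonzeroSum w C = ∑ b with b ∈ C, w b - w 0 := by
  rw [nonzeroSum, ← Finset.filter_filter, Finset.filter_ne', Finset.sum_erase_eq_sub (by simp)]

lemma nonzeroSum_one (C : Submodule F V) :
    nonzeroSum (fun _ => 1) C = (Nat.card C : ℝ) - 1 := by
  classical
  rw [nonzeroSum_eq_sum_sub, Finset.sum_const, nsmul_one, Nat.card_eq_fintype_card,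
    Fintype.card_subtype]

lemma nonzeroSum_eq_mul {w : V → ℝ} {a : ℝ} (hw : ∀ b, b ≠ 0 → w b = a) (C : Submodule F V) :
    nonzeroSum w C = nonzeroSum (fun _ => 1) C * a := by
  classical
  rw [nonzeroSum, nonzeroSum, Finset.sum_mul]
  refine Finset.sum_congr rfl fun b hb => ?_
  rw [one_mul, hw b (Finset.mem_filter.1 hb).2.2]

lemma nonzeroSum_one_mul_sum_map [Fintype (V ≃ₗ[F] V)] (w : V → ℝ) (C : Submodule F V) :
    nonzeroSum (fun _ => 1) (⊤ : Submodule F V) *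
        ∑ g : V ≃ₗ[F] V, nonzeroSum w (C.map (g : V →ₗ[F] V)) =
      Fintype.card (V ≃ₗ[F] V) *
        (nonzeroSum (fun _ => 1) C * nonzeroSum w (⊤ : Submodule F V)) := by
  obtain ⟨a, ha⟩ := exists_sum_linearEquiv_eq (F := F) w
  have hsum (D : Submodule F V) : ∑ g : V ≃ₗ[F] V, nonzeroSum w (D.map (g : V →ₗ[F] V)) =
      nonzeroSum (fun _ => 1) D * a := by
    simp_rw [nonzeroSum_map]
    rw [← nonzeroSum_eq_mul ha]
    exact Finset.sum_comm
  have htop : nonzeroSum (fun _ => 1) (⊤ : Submodule F V) * a =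
      Fintype.card (V ≃ₗ[F] V) * nonzeroSum w (⊤ : Submodule F V) := by
    rw [← hsum]
    simp_rw [Submodule.map_top, LinearEquiv.range]
    rw [Finset.sum_const, Finset.card_univ, nsmul_eq_mul]
  rw [hsum, mul_left_comm, htop]
  ring

-- Under a uniformly random automorphism every nonzero word becomes uniform on `V \ {0}`, so some
-- image of `C` does no worse than the average.
lemma exists_nonzeroSum_map_le (w : V → ℝ) (C : Submodule F V) :
    ∃ g : V ≃ₗ[F] V,
      nonzeroSum (fun _ => 1) (⊤ : Submodule F V) * nonzeroSum w (C.map (g : V →ₗ[F] V)) ≤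
        nonzeroSum (fun _ => 1) C * nonzeroSum w (⊤ : Submodule F V) := by
  have : Finite (V ≃ₗ[F] V) := DFunLike.finite _
  have := Fintype.ofFinite (V ≃ₗ[F] V)
  obtain ⟨g, -, hg⟩ := Finset.exists_le_of_sum_le (s := Finset.univ)
    (f := fun g : V ≃ₗ[F] V => nonzeroSum (fun _ => 1) (⊤ : Submodule F V) *
      nonzeroSum w (C.map (g : V →ₗ[F] V)))
    (g := fun _ => nonzeroSum (fun _ => 1) C * nonzeroSum w (⊤ : Submodule F V))
    Finset.univ_nonempty
    (by rw [← Finset.mul_sum, nonzeroSum_one_mul_sum_map, Finset.sum_const, Finset.card_univ,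
      nsmul_eq_mul])
  exact ⟨g, hg⟩

lemma exists_finrank_eq_card_mul_nonzeroSum_le [Fintype F] {w : V → ℝ} (hw : ∀ b, 0 ≤ w b)
    {k : ℕ} (hk : k ≤ Module.finrank F V) :
    ∃ C : Submodule F V, Module.finrank F C = k ∧
      (Fintype.card V : ℝ) * nonzeroSum w C ≤
        (Fintype.card F : ℝ) ^ k * nonzeroSum w (⊤ : Submodule F V) := by
  obtain ⟨C, rfl⟩ := exists_submodule_finrank_eq hk
  obtain ⟨g, hg⟩ := exists_nonzeroSum_map_le w C
  refine ⟨C.map (g : V →ₗ[F] V), LinearEquiv.finrank_map_eq g C, ?_⟩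
  have htop : nonzeroSum w (C.map (g : V →ₗ[F] V)) ≤ nonzeroSum w (⊤ : Submodule F V) :=
    nonzeroSum_mono hw le_top
  rw [nonzeroSum_one, nonzeroSum_one, Nat.card_congr (Submodule.topEquiv (R := F) (M := V)).toEquiv,
    Nat.card_eq_fintype_card, Module.natCard_eq_pow_finrank (K := F), Nat.card_eq_fintype_card,
    Nat.cast_pow] at hg
  linarith

end LinearCode

section BinaryCode

lemma prod_ite_eq_zero {ι β : Type*} [Fintype ι] [Zero β] [DecidableEq β] (b : ι → β) (c d : ℝ) :
    ∏ i, (if b i = 0 then c else d) =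
      c ^ (Fintype.card ι - hammingNorm b) * d ^ hammingNorm b := by
  have hcard : (Finset.univ.filter fun i => b i = 0).card = Fintype.card ι - hammingNorm b := by
    rw [← Finset.card_univ,
      ← Finset.card_filter_add_card_filter_not (s := Finset.univ) fun i => b i = 0]
    exact (Nat.add_sub_cancel _ _).symm
  rw [Finset.prod_ite, Finset.prod_const, Finset.prod_const, hcard]
  rfl

variable {n : ℕ}

open Classical in
lemma weightCount_eq_card (C : Submodule (ZMod 2) (Fin n → ZMod 2)) (z : ℕ) :
    weightCount C z = (Finset.univ.filter fun b => b ∈ C ∧ hammingNorm b = z).card := by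
  rw [weightCount, ← Set.ncard_coe_finset, Finset.coe_filter_univ]

lemma weightCount_bot {z : ℕ} (hz : 1 ≤ z) :
    weightCount (⊥ : Submodule (ZMod 2) (Fin n → ZMod 2)) z = 0 := by
  classical
  rw [weightCount_eq_card, Finset.card_eq_zero, Finset.filter_eq_empty_iff]
  rintro b - ⟨hb, hbz⟩
  rw [(Submodule.mem_bot (ZMod 2)).1 hb, hammingNorm_zero] at hbz
  omega

lemma nonzeroSum_hammingNorm (f : ℕ → ℝ) (C : Submodule (ZMod 2) (Fin n → ZMod 2)) :
    nonzeroSum (fun b => f (hammingNorm b)) C =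
      ∑ z ∈ Finset.Icc 1 n, weightCount C z * f z := by
  classical
  have hmaps : ∀ b ∈ Finset.univ.filter fun b : Fin n → ZMod 2 => b ∈ C ∧ b ≠ 0,
      hammingNorm b ∈ Finset.Icc 1 n := fun b hb =>
    Finset.mem_Icc.2 ⟨hammingNorm_pos_iff.2 (Finset.mem_filter.1 hb).2.2,
      hammingNorm_le_card_fintype.trans_eq (Fintype.card_fin n)⟩
  have hsum : nonzeroSum (fun b => f (hammingNorm b)) C =
      ∑ b : Fin n → ZMod 2 with b ∈ C ∧ b ≠ 0, f (hammingNorm b) := by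
    unfold nonzeroSum
    congr!
  rw [hsum, ← Finset.sum_fiberwise_of_maps_to hmaps]
  refine Finset.sum_congr rfl fun z hz => ?_
  have hfiber : (Finset.univ.filter fun b => b ∈ C ∧ b ≠ 0).filter (fun b => hammingNorm b = z) =
      Finset.univ.filter fun b => b ∈ C ∧ hammingNorm b = z := by
    ext b
    have hz0 : hammingNorm b = z → b ≠ 0 := by
      rintro rfl
      exact hammingNorm_pos_iff.1 (Finset.mem_Icc.1 hz).1
    simp only [Finset.mem_filter, Finset.mem_univ, true_and]
    tauto
  rw [hfiber, weightCount_eq_card, ← nsmul_eq_mul, ← Finset.sum_const]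
  exact Finset.sum_congr rfl fun b hb => by rw [(Finset.mem_filter.1 hb).2.2]

lemma weightCount_mul_le (C : Submodule (ZMod 2) (Fin n → ZMod 2)) (z : ℕ) {p : ℝ} (hp0 : 0 ≤ p)
    (hp1 : p ≤ 1) : weightCount C z * ((1 - p) ^ (n - z) * p ^ z) ≤ 1 := by
  classical
  have hp1' := sub_nonneg.2 hp1
  have hsum : ∑ b : Fin n → ZMod 2, ∏ i, (if b i = 0 then 1 - p else p) = 1 := by
    rw [← Fintype.sum_pow (fun a : ZMod 2 => if a = 0 then 1 - p else p) n]
    have : ∑ a : ZMod 2, (if a = 0 then 1 - p else p) = 1 := by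
      have huniv : (Finset.univ : Finset (ZMod 2)) = {0, 1} := by decide
      rw [huniv, Finset.sum_pair (by decide)]
      simp
    rw [this, one_pow]
  have hword : ∀ b ∈ Finset.univ.filter fun b => b ∈ C ∧ hammingNorm b = z,
      (1 - p) ^ (n - z) * p ^ z = ∏ i, (if b i = 0 then 1 - p else p) := fun b hb => by
    rw [prod_ite_eq_zero, (Finset.mem_filter.1 hb).2.2, Fintype.card_fin]
  have hnonneg (b : Fin n → ZMod 2) : 0 ≤ ∏ i, (if b i = 0 then 1 - p else p) :=
    Finset.prod_nonneg fun i _ => by split_ifs <;> assumption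
  rw [weightCount_eq_card, ← nsmul_eq_mul, ← Finset.sum_const, Finset.sum_congr rfl hword]
  exact (Finset.sum_le_univ_sum_of_nonneg hnonneg).trans_eq hsum

lemma pow_eq_two_rpow {x : ℝ} {m : ℕ} (hx : 0 ≤ x) (h : x = 0 → m = 0) :
    x ^ m = (2 : ℝ) ^ (m * Real.logb 2 x) := by
  rcases hx.eq_or_lt with rfl | hx
  · simp [h rfl]
  · rw [mul_comm, Real.rpow_mul zero_le_two, Real.rpow_logb two_pos one_lt_two.ne' hx,
      Real.rpow_natCast]

lemma two_rpow_neg_mul_h2 {z : ℕ} (hz : z ≤ n) :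
    (1 - (z : ℝ) / n) ^ (n - z) * ((z : ℝ) / n) ^ z = (2 : ℝ) ^ (-(n * h2 ((z : ℝ) / n))) := by
  rcases n.eq_zero_or_pos with rfl | hn
  · obtain rfl := Nat.le_zero.1 hz
    simp
  have hn' : (0 : ℝ) < n := by exact_mod_cast hn
  have hle : (z : ℝ) / n ≤ 1 := (div_le_one hn').2 (by exact_mod_cast hz)
  rw [pow_eq_two_rpow (sub_nonneg.2 hle), pow_eq_two_rpow (by positivity),
    ← Real.rpow_add two_pos, h2, Nat.cast_sub hz]
  · congr 1
    field_simp
    ring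
  · intro h
    simpa [hn.ne'] using h
  · intro h
    rw [sub_eq_zero, eq_comm, div_eq_one_iff_eq hn'.ne'] at h
    have : z = n := by exact_mod_cast h
    omega

lemma weightCount_mul_two_rpow_le (C : Submodule (ZMod 2) (Fin n → ZMod 2)) {z : ℕ} (hz : z ≤ n) :
    weightCount C z * (2 : ℝ) ^ (-(n * h2 ((z : ℝ) / n))) ≤ 1 := by
  rw [← two_rpow_neg_mul_h2 hz]
  exact weightCount_mul_le C z (by positivity)
    (div_le_one_of_le₀ (by exact_mod_cast hz) (Nat.cast_nonneg n))

lemma exists_finrank_eq_weightCount_le {k : ℕ} (hk : k ≤ n) :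
    ∃ C : Submodule (ZMod 2) (Fin n → ZMod 2), Module.finrank (ZMod 2) C = k ∧
      ∀ z ∈ Finset.Icc 1 n,
        (weightCount C z : ℝ) ≤ 2 ^ k * n * (2 : ℝ) ^ (n * (h2 ((z : ℝ) / n) - 1)) := by
  set f : ℕ → ℝ := fun z => (2 : ℝ) ^ (-(n * h2 ((z : ℝ) / n))) with hf
  have hf0 : ∀ z, 0 ≤ f z := fun z => by positivity
  obtain ⟨C, hC, hle⟩ := exists_finrank_eq_card_mul_nonzeroSum_le (F := ZMod 2)
    (w := fun b : Fin n → ZMod 2 => f (hammingNorm b)) (fun b => hf0 _) (hk.trans_eq (by simp))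
  refine ⟨C, hC, fun z hz => ?_⟩
  have htop : ∑ z ∈ Finset.Icc 1 n,
      weightCount (⊤ : Submodule (ZMod 2) (Fin n → ZMod 2)) z * f z ≤ n := by
    refine (Finset.sum_le_card_nsmul _ _ 1 fun z hz =>
      weightCount_mul_two_rpow_le _ (Finset.mem_Icc.1 hz).2).trans_eq ?_
    simp
  have hterm : weightCount C z * f z ≤ ∑ z ∈ Finset.Icc 1 n, weightCount C z * f z :=
    Finset.single_le_sum (f := fun z => weightCount C z * f z)
      (fun z _ => mul_nonneg (Nat.cast_nonneg _) (hf0 z)) hz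
  rw [nonzeroSum_hammingNorm, nonzeroSum_hammingNorm, ZMod.card, Fintype.card_fun, ZMod.card,
    Fintype.card_fin] at hle
  push_cast at hle
  have hmul : 2 ^ n * (weightCount C z * f z) ≤ 2 ^ k * (n : ℝ) :=
    (mul_le_mul_of_nonneg_left hterm (by positivity)).trans
      (hle.trans (mul_le_mul_of_nonneg_left htop (by positivity)))
  have hexp : (2 : ℝ) ^ n * f z * (2 : ℝ) ^ (n * (h2 ((z : ℝ) / n) - 1)) = 1 := by
    rw [hf, ← Real.rpow_natCast, ← Real.rpow_add two_pos, ← Real.rpow_add two_pos]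
    ring_nf
    simp
  calc (weightCount C z : ℝ)
      = 2 ^ n * (weightCount C z * f z) * (2 : ℝ) ^ (n * (h2 ((z : ℝ) / n) - 1)) := by
        linear_combination -(weightCount C z : ℝ) * hexp
    _ ≤ _ := by gcongr

/-- The dimension of the random linear codes of length `n` at rate `r`. The correction by
`logb 2 n` makes the average spectrum bound hold for all `n` weights at once. -/
def gvDim (r : ℝ) (n : ℕ) : ℕ := ⌊n * r - Real.logb 2 n⌋₊

lemma gvDim_le {r : ℝ} (hr : 0 ≤ r) (n : ℕ) : (gvDim r n : ℝ) ≤ n * r :=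
  (Nat.cast_le.2 (Nat.floor_le_floor (sub_le_self _
    (div_nonneg (Real.log_natCast_nonneg n) (Real.log_nonneg one_le_two))))).trans
    (Nat.floor_le (by positivity))

lemma tendsto_logb_two_div_atTop : Tendsto (fun n : ℕ => Real.logb 2 n / n) atTop (𝓝 0) := by
  have hlog :=
    (Real.isLittleO_log_id_atTop.comp_tendsto tendsto_natCast_atTop_atTop).tendsto_div_nhds_zero
  simpa [Function.comp_def, Real.logb, div_right_comm] using hlog.div_const (Real.log 2)

lemma tendsto_gvDim_div {r : ℝ} (hr : 0 ≤ r) :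
    Tendsto (fun n : ℕ => (gvDim r n : ℝ) / n) atTop (𝓝 r) := by
  have hlower : Tendsto (fun n : ℕ => r - Real.logb 2 n / n - 1 / n) atTop (𝓝 r) := by
    simpa using (tendsto_logb_two_div_atTop.const_sub r).sub tendsto_one_div_atTop_nhds_zero_nat
  refine tendsto_of_tendsto_of_tendsto_of_le_of_le' hlower tendsto_const_nhds ?_ ?_
  · filter_upwards [eventually_gt_atTop 0] with n hn
    have hn' : (0 : ℝ) < n := by exact_mod_cast hn
    rw [le_div_iff₀ hn', sub_mul, sub_mul, div_mul_cancel₀ _ hn'.ne', div_mul_cancel₀ _ hn'.ne',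
      mul_comm r]
    exact (Nat.sub_one_lt_floor _).le
  · filter_upwards [eventually_gt_atTop 0] with n hn
    rw [div_le_iff₀ (by exact_mod_cast hn), mul_comm r]
    exact gvDim_le hr n

lemma exists_finrank_eq_gvDim {r : ℝ} (h0 : 0 ≤ r) (h1 : r ≤ 1) (n : ℕ) :
    ∃ C : Submodule (ZMod 2) (Fin n → ZMod 2), Module.finrank (ZMod 2) C = gvDim r n ∧
      ∀ z ∈ Finset.Icc 1 n,
        (weightCount C z : ℝ) ≤ (2 : ℝ) ^ (n * (r - 1 + h2 ((z : ℝ) / n))) := by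
  rcases (gvDim r n).eq_zero_or_pos with hk | hk
  · refine ⟨⊥, by rw [finrank_bot, hk], fun z hz => ?_⟩
    rw [weightCount_bot (Finset.mem_Icc.1 hz).1, Nat.cast_zero]
    positivity
  have hn : 0 < n := Nat.pos_of_ne_zero fun h => by simp [gvDim, h] at hk
  have hn' : (0 : ℝ) < n := by exact_mod_cast hn
  have hkn : gvDim r n ≤ n := by
    exact_mod_cast (gvDim_le h0 n).trans (mul_le_of_le_one_right hn'.le h1)
  have hpow : 2 ^ gvDim r n * (n : ℝ) ≤ (2 : ℝ) ^ (n * r) := by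
    calc 2 ^ gvDim r n * (n : ℝ) ≤ (2 : ℝ) ^ (n * r - Real.logb 2 n) * n := by
          rw [← Real.rpow_natCast]
          gcongr
          · exact one_le_two
          · exact Nat.floor_le (Nat.pos_of_floor_pos hk).le
      _ = (2 : ℝ) ^ (n * r) := by
          rw [Real.rpow_sub two_pos, Real.rpow_logb two_pos one_lt_two.ne' hn',
            div_mul_cancel₀ _ hn'.ne']
  obtain ⟨C, hC, hle⟩ := exists_finrank_eq_weightCount_le hkn
  refine ⟨C, hC, fun z hz => (hle z hz).trans ?_⟩
  rw [show n * (r - 1 + h2 ((z : ℝ) / n)) = n * r + n * (h2 ((z : ℝ) / n) - 1) by ring,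
    Real.rpow_add two_pos]
  gcongr

lemma weightCount_eq_zero {r : ℝ} (h0 : 0 ≤ r) (h1 : r ≤ 1)
    {C : Submodule (ZMod 2) (Fin n → ZMod 2)} {z : ℕ} (hz : z ∈ Finset.Icc 1 n)
    (hC : (weightCount C z : ℝ) ≤ (2 : ℝ) ^ (n * (r - 1 + h2 ((z : ℝ) / n))))
    (hlt : (z : ℝ) < deltaGV r * n) : weightCount C z = 0 := by
  obtain ⟨hz1, hzn⟩ := Finset.mem_Icc.1 hz
  have hn : (0 : ℝ) < n := by exact_mod_cast hz1.trans hzn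
  have hlt' : (z : ℝ) / n < deltaGV r := (div_lt_iff₀ hn).2 hlt
  have hh2 : h2 ((z : ℝ) / n) < 1 - r := (lt_deltaGV_iff h0 h1
    ⟨by positivity, hlt'.le.trans (deltaGV_spec h0 h1).1⟩).1 hlt'
  have hcount : (weightCount C z : ℝ) < 1 := hC.trans_lt
    (Real.rpow_lt_one_of_one_lt_of_neg one_lt_two (mul_neg_of_pos_of_neg hn (by linarith)))
  exact Nat.lt_one_iff.1 (by exact_mod_cast hcount)

lemma nonzeroSum_pow_hammingNorm_le {ε r : ℝ} (hε0 : 0 < ε) (hε1 : ε < 1) (h0 : 0 ≤ r) (h1 : r ≤ 1)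
    {C : Submodule (ZMod 2) (Fin n → ZMod 2)}
    (hC : ∀ z ∈ Finset.Icc 1 n,
      (weightCount C z : ℝ) ≤ (2 : ℝ) ^ (n * (r - 1 + h2 ((z : ℝ) / n)))) :
    nonzeroSum (fun b => (2 * alpha ε) ^ hammingNorm b) C ≤
      n * (2 : ℝ) ^ (-(n * expurgatedBSC ε r)) := by
  rw [nonzeroSum_hammingNorm fun z => (2 * alpha ε) ^ z]
  refine (Finset.sum_le_card_nsmul _ _ ((2 : ℝ) ^ (-(n * expurgatedBSC ε r)))
    fun z hz => ?_).trans_eq (by simp)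
  have hα : 0 < 2 * alpha ε := mul_pos two_pos (alpha_pos hε0 hε1)
  rcases lt_or_ge (z : ℝ) (deltaGV r * n) with hlt | hge
  · rw [weightCount_eq_zero h0 h1 hz (hC z hz) hlt, Nat.cast_zero, zero_mul]
    positivity
  obtain ⟨hz1, hzn⟩ := Finset.mem_Icc.1 hz
  have hn : (0 : ℝ) < n := by exact_mod_cast hz1.trans hzn
  have hexp := mul_le_mul_of_nonneg_left (spectrum_exponent_le hε0 hε1 h0
    ((le_div_iff₀ hn).2 hge) ((div_le_one hn).2 (by exact_mod_cast hzn))) hn.le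
  calc weightCount C z * (2 * alpha ε) ^ z
      ≤ (2 : ℝ) ^ (n * (r - 1 + h2 ((z : ℝ) / n))) * (2 * alpha ε) ^ z := by
        gcongr
        exact hC z hz
    _ = (2 : ℝ) ^ (n * (r - 1 + (h2 ((z : ℝ) / n) + (z : ℝ) / n * Real.logb 2 (2 * alpha ε)))) := by
        rw [pow_eq_two_rpow hα.le fun h => absurd h hα.ne', ← Real.rpow_add two_pos]
        congr 1
        field_simp
        ring
    _ ≤ (2 : ℝ) ^ (-(n * expurgatedBSC ε r)) :=
        Real.rpow_le_rpow_of_exponent_le one_le_two (by linarith)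

lemma exists_hasGVSpectrum {ε r : ℝ} (hε0 : 0 < ε) (hε1 : ε < 1) (h0 : 0 ≤ r) (h1 : r ≤ 1) :
    ∃ C : ∀ n : ℕ, Submodule (ZMod 2) (Fin n → ZMod 2), HasGVSpectrum r C ∧
      (∀ n, Module.finrank (ZMod 2) (C n) = gvDim r n) ∧
      ∀ n, nonzeroSum (fun b => (2 * alpha ε) ^ hammingNorm b) (C n) ≤
        n * (2 : ℝ) ^ (-(n * expurgatedBSC ε r)) := by
  choose C hdim hC using exists_finrank_eq_gvDim h0 h1
  refine ⟨C, ⟨fun _ => 0, tendsto_const_nhds, fun n z hz1 hzn => ?_⟩, hdim,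
    fun n => nonzeroSum_pow_hammingNorm_le hε0 hε1 h0 h1 (hC n)⟩
  have hz : z ∈ Finset.Icc 1 n := Finset.mem_Icc.2 ⟨hz1, hzn⟩
  exact ⟨weightCount_eq_zero h0 h1 hz (hC n z hz), by simpa only [add_zero] using hC n z hz⟩

end BinaryCode

section UnionBound

variable {X Y : Type} {W : X → Y → ℝ}

lemma memoryless_nonneg (hW : ∀ x y, 0 ≤ W x y) {n : ℕ} (x : Fin n → X) (y : Fin n → Y) :
    0 ≤ memoryless W n x y :=
  Finset.prod_nonneg fun _ _ => hW _ _

variable [Fintype Y] {n : ℕ} {ι κ : Type} [DecidableEq ι] [DecidableEq κ]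

lemma sum_memoryless (hW1 : ∀ x, ∑ y, W x y = 1) (x : Fin n → X) :
    ∑ y, memoryless W n x y = 1 := by
  simp only [memoryless, ← Fintype.prod_sum, hW1, Finset.prod_const_one]

lemma bhatt_eq_prod (hW : ∀ x y, 0 ≤ W x y) (k : ℕ) (x x' : Fin k → X) :
    bhatt W k x x' = ∏ i, ∑ y, Real.sqrt (W (x i) y * W (x' i) y) := by
  rw [Fintype.prod_sum, bhatt]
  refine Finset.sum_congr rfl fun y _ => ?_
  rw [memoryless, memoryless, ← Finset.prod_mul_distrib,
    Real.sqrt_prod _ fun i _ => mul_nonneg (hW _ _) (hW _ _)]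

lemma errorGiven_nonneg (hW : ∀ x y, 0 ≤ W x y) (enc : ι → Fin n → X) (dec : (Fin n → Y) → ι)
    (m : ι) : 0 ≤ errorGiven W enc dec m :=
  Finset.sum_nonneg fun y _ => by
    split_ifs
    exacts [le_rfl, memoryless_nonneg hW _ _]

lemma errorGiven_le_one (hW : ∀ x y, 0 ≤ W x y) (hW1 : ∀ x, ∑ y, W x y = 1)
    (enc : ι → Fin n → X) (dec : (Fin n → Y) → ι) (m : ι) : errorGiven W enc dec m ≤ 1 := by
  rw [← sum_memoryless hW1 (enc m)]
  refine Finset.sum_le_sum fun y _ => ?_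
  split_ifs
  exacts [memoryless_nonneg hW _ _, le_rfl]

-- Maximum likelihood decoding: if `y` is decoded to `m' ≠ m`, then
-- `W (y | m) ≤ √(W (y | m) * W (y | m'))`.
lemma exists_errorGiven_le_sum_bhatt (hW : ∀ x y, 0 ≤ W x y) [Fintype ι] [Nonempty ι]
    (enc : ι → Fin n → X) :
    ∃ dec : (Fin n → Y) → ι, ∀ m,
      errorGiven W enc dec m ≤ ∑ m' ∈ Finset.univ.erase m, bhatt W n (enc m) (enc m') := by
  choose dec hdec using fun y : Fin n → Y =>
    Finite.exists_max fun m : ι => memoryless W n (enc m) y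
  refine ⟨dec, fun m => ?_⟩
  simp only [errorGiven, bhatt]
  rw [Finset.sum_comm]
  refine Finset.sum_le_sum fun y _ => ?_
  split_ifs with h
  · exact Finset.sum_nonneg fun _ _ => Real.sqrt_nonneg _
  have hsqrt : memoryless W n (enc m) y ≤
      Real.sqrt (memoryless W n (enc m) y * memoryless W n (enc (dec y)) y) := by
    refine Real.le_sqrt_of_sq_le ?_
    rw [sq]
    exact mul_le_mul_of_nonneg_left (hdec y m) (memoryless_nonneg hW _ _)
  exact hsqrt.trans (Finset.single_le_sum
    (f := fun m' => Real.sqrt (memoryless W n (enc m) y * memoryless W n (enc m') y))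
    (fun _ _ => Real.sqrt_nonneg _) (Finset.mem_erase.2 ⟨h, Finset.mem_univ _⟩))

lemma maxError_nonneg (hW : ∀ x y, 0 ≤ W x y) (enc : ι → Fin n → X) : 0 ≤ maxError W enc :=
  Real.iInf_nonneg fun _ => Real.iSup_nonneg fun _ => errorGiven_nonneg hW _ _ _

lemma maxError_le [Finite ι] [Nonempty ι] {enc : ι → Fin n → X} {B : ℝ} (dec : (Fin n → Y) → ι)
    (h : ∀ m, errorGiven W enc dec m ≤ B) : maxError W enc ≤ B :=
  (ciInf_le (Set.finite_range _).bddBelow dec).trans (ciSup_le h)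

lemma maxError_le_one (hW : ∀ x y, 0 ≤ W x y) (hW1 : ∀ x, ∑ y, W x y = 1) [Finite ι] [Nonempty ι]
    (enc : ι → Fin n → X) : maxError W enc ≤ 1 :=
  maxError_le (fun _ => Classical.arbitrary ι) fun m => errorGiven_le_one hW hW1 enc _ m

lemma maxError_le_of_sum_bhatt_le (hW : ∀ x y, 0 ≤ W x y) [Fintype ι] [Nonempty ι]
    {enc : ι → Fin n → X} {B : ℝ}
    (h : ∀ m, ∑ m' ∈ Finset.univ.erase m, bhatt W n (enc m) (enc m') ≤ B) :
    maxError W enc ≤ B := by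
  obtain ⟨dec, hdec⟩ := exists_errorGiven_le_sum_bhatt hW enc
  exact maxError_le dec fun m => (hdec m).trans (h m)

lemma maxError_comp_le (hW : ∀ x y, 0 ≤ W x y) [Finite ι] [Nonempty ι] [Finite κ]
    (enc : κ → Fin n → X) {f : ι → κ} (hf : Function.Injective f) :
    maxError W (enc ∘ f) ≤ maxError W enc := by
  have : Nonempty κ := Nonempty.map f inferInstance
  refine le_ciInf fun dec => maxError_le (Function.invFun f ∘ dec) fun m => ?_
  refine le_trans ?_ (le_ciSup (Set.finite_range _).bddAbove (f m))
  refine Finset.sum_le_sum fun y _ => ?_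
  by_cases h : dec y = f m
  · simp [h, Function.leftInverse_invFun hf m]
  · rw [if_neg h]
    split_ifs
    exacts [memoryless_nonneg hW _ _, le_rfl]

lemma avgError_nonneg (hW : ∀ x y, 0 ≤ W x y) [Fintype ι] (enc : ι → Fin n → X) :
    0 ≤ avgError W enc :=
  Real.iInf_nonneg fun _ =>
    div_nonneg (Finset.sum_nonneg fun _ _ => errorGiven_nonneg hW _ _ _) (Nat.cast_nonneg _)

lemma avgError_le_maxError [Fintype ι] [Nonempty ι] (enc : ι → Fin n → X) :
    avgError W enc ≤ maxError W enc := by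
  refine ciInf_mono (Set.finite_range _).bddBelow fun dec => ?_
  rw [div_le_iff₀' (Nat.cast_pos.2 Fintype.card_pos), ← nsmul_eq_mul]
  exact Finset.sum_le_card_nsmul _ _ _ fun m _ => le_ciSup (Set.finite_range _).bddAbove m

variable [Finite X] {M : ℕ}

lemma optMaxError_le_maxError (hW : ∀ x y, 0 ≤ W x y) (hM : 0 < M) [Fintype κ]
    (hκ : M ≤ Fintype.card κ) (enc : κ → Fin n → X) : optMaxError W M n ≤ maxError W enc := by
  have : Nonempty (Fin M) := ⟨⟨0, hM⟩⟩
  have hf : Function.Injective ((Fintype.equivFin κ).symm ∘ Fin.castLE hκ) :=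
    (Fintype.equivFin κ).symm.injective.comp (Fin.castLE_injective hκ)
  exact (ciInf_le (Set.finite_range _).bddBelow _).trans (maxError_comp_le hW enc hf)

lemma optAvgError_le_optMaxError (hM : 0 < M) : optAvgError W M n ≤ optMaxError W M n :=
  have : Nonempty (Fin M) := ⟨⟨0, hM⟩⟩
  ciInf_mono (Set.finite_range _).bddBelow fun enc => avgError_le_maxError enc

end UnionBound

section Exponent

lemma expo_le_expo {p p' : ℝ} (h0 : 0 ≤ p) (h : p ≤ p') (n : ℕ) : expo n p' ≤ expo n p := by
  rcases h0.eq_or_lt with rfl | h0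
  · simp [expo]
  have h0' := h0.trans_le h
  rw [expo, expo, if_neg h0.ne', if_neg h0'.ne', EReal.coe_le_coe_iff]
  gcongr
  exact one_lt_two

lemma expo_one (n : ℕ) : expo n 1 = 0 := by simp [expo]

lemma tendsto_expo_mul_two_rpow (E : ℝ) :
    Tendsto (fun n : ℕ => expo n (n * (2 : ℝ) ^ (-(n * E)))) atTop (𝓝 (E : EReal)) := by
  have hlim : Tendsto (fun n : ℕ => E - Real.logb 2 n / n) atTop (𝓝 E) := by
    simpa using tendsto_logb_two_div_atTop.const_sub E
  refine ((continuous_coe_real_ereal.tendsto E).comp hlim).congr' ?_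
  filter_upwards [eventually_gt_atTop 0] with n hn
  have hn' : (0 : ℝ) < n := by exact_mod_cast hn
  rw [expo, if_neg (by positivity), one_div (_ * _), Real.logb_inv,
    Real.logb_mul hn'.ne' (by positivity), Real.logb_rpow two_pos one_lt_two.ne',
    Function.comp_apply, EReal.coe_eq_coe_iff]
  field_simp
  ring

lemma le_liminf_expo {p : ℕ → ℝ} {E : ℝ} (h0 : ∀ n, 0 ≤ p n)
    (h : ∀ n : ℕ, p n ≤ n * (2 : ℝ) ^ (-(n * E))) :
    (E : EReal) ≤ liminf (fun n => expo n (p n)) atTop :=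
  (tendsto_expo_mul_two_rpow E).liminf_eq.symm.trans_le
    (liminf_le_liminf (Eventually.of_forall fun n => expo_le_expo (h0 n) (h n) n))

variable {X Y : Type} [Finite X] [Fintype Y] {W : X → Y → ℝ}

lemma ceil_two_rpow_pos (t : ℝ) : 0 < ⌈(2 : ℝ) ^ t⌉₊ :=
  Nat.ceil_pos.2 (Real.rpow_pos_of_pos two_pos t)

lemma reliabilityMax_le_reliabilityAvg (hW : ∀ x y, 0 ≤ W x y) (R : ℝ) :
    reliabilityMax W R ≤ reliabilityAvg W R :=
  limsup_le_limsup (Eventually.of_forall fun n =>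
    expo_le_expo (Real.iInf_nonneg fun _ => avgError_nonneg hW _)
      (optAvgError_le_optMaxError (ceil_two_rpow_pos _)) n)

lemma reliabilityMax_nonneg [Nonempty X] (hW : ∀ x y, 0 ≤ W x y) (hW1 : ∀ x, ∑ y, W x y = 1)
    (R : ℝ) : 0 ≤ reliabilityMax W R := by
  refine le_limsup_of_frequently_le (Frequently.of_forall fun n => ?_)
  have : Nonempty (Fin ⌈(2 : ℝ) ^ (n * R)⌉₊) := ⟨⟨0, ceil_two_rpow_pos _⟩⟩
  rw [← expo_one n]
  exact expo_le_expo (Real.iInf_nonneg fun _ => maxError_nonneg hW _)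
    ((ciInf_le (Set.finite_range _).bddBelow (Classical.arbitrary _)).trans
      (maxError_le_one hW hW1 _)) n

lemma liminf_expo_maxError_le_reliabilityMax (hW : ∀ x y, 0 ≤ W x y) {κ : ℕ → Type}
    [∀ n, Fintype (κ n)] [∀ n, DecidableEq (κ n)] [∀ n, Nonempty (κ n)]
    (enc : ∀ n, κ n → Fin n → X) {R R' : ℝ} (hR : R < R')
    (hκ : Tendsto (fun n : ℕ => Real.logb 2 (Fintype.card (κ n)) / n) atTop (𝓝 R')) :
    liminf (fun n => expo n (maxError W (enc n))) atTop ≤ reliabilityMax W R := by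
  refine (liminf_le_liminf ?_).trans liminf_le_limsup
  filter_upwards [hκ.eventually_const_lt hR, eventually_gt_atTop 0] with n hn hn0
  refine expo_le_expo (Real.iInf_nonneg fun _ => maxError_nonneg hW _)
    (optMaxError_le_maxError hW (ceil_two_rpow_pos _) ?_ (enc n)) n
  rw [Nat.ceil_le, ← Real.le_logb_iff_rpow_le one_lt_two (Nat.cast_pos.2 Fintype.card_pos),
    mul_comm]
  exact ((lt_div_iff₀ (Nat.cast_pos.2 hn0)).1 hn).le

end Exponent

section Kernel

variable {q : ℕ}

/-- The kernel on the `q`-cycle with weight `1` at equal letters and weight `β` at each of the two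
neighbours. The neighbours coincide when `q = 2`, and that letter then gets weight `2 * β`. -/
def cycleKernel (q : ℕ) (β : ℝ) : Matrix (ZMod q) (ZMod q) ℝ := Matrix.of fun x y =>
  (if y = x then 1 else 0) + (if y = x + 1 then β else 0) + (if y = x - 1 then β else 0)

lemma cycleKernel_nonneg {β : ℝ} (hβ : 0 ≤ β) (x y : ZMod q) : 0 ≤ cycleKernel q β x y := by
  simp only [cycleKernel, Matrix.of_apply]
  positivity

variable {ε : ℝ}

lemma typewriter_nonneg (hε0 : 0 ≤ ε) (hε1 : ε ≤ 1) (x y : ZMod q) : 0 ≤ typewriter q ε x y := by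
  unfold typewriter
  split_ifs <;> linarith

lemma comp_typewriter (hq : 1 < q) {f : ℝ → ℝ} (hf : f 0 = 0) (x y : ZMod q) :
    f (typewriter q ε x y) =
      (if y = x then f (1 - ε) else 0) + (if y = x + 1 then f ε else 0) := by
  have : Fact (1 < q) := ⟨hq⟩
  by_cases h : y = x
  · simp [typewriter, h]
  · simp [typewriter, h, apply_ite f, hf]

variable [NeZero q]

lemma sum_typewriter (hq : 1 < q) (ε : ℝ) (x : ZMod q) : ∑ y, typewriter q ε x y = 1 := by
  have hsum := fun y => comp_typewriter (ε := ε) hq (f := id) rfl x y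
  simp only [id] at hsum
  simp [hsum, Finset.sum_add_distrib]

lemma sum_sqrt_typewriter (hq : 1 < q) (hε0 : 0 ≤ ε) (hε1 : ε ≤ 1) (x x' : ZMod q) :
    ∑ y, Real.sqrt (typewriter q ε x y * typewriter q ε x' y) =
      cycleKernel q (alpha ε) x x' := by
  have h0 := Real.mul_self_sqrt hε0
  have h1 := Real.mul_self_sqrt (sub_nonneg.2 hε1)
  have hα : alpha ε = Real.sqrt ε * Real.sqrt (1 - ε) := Real.sqrt_mul hε0 _
  simp only [fun y => Real.sqrt_mul (typewriter_nonneg hε0 hε1 x y) (typewriter q ε x' y),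
    comp_typewriter hq Real.sqrt_zero, mul_add, mul_ite, mul_zero,
    Finset.sum_add_distrib, Finset.sum_ite_eq', Finset.mem_univ, if_true, cycleKernel,
    Matrix.of_apply, hα, add_left_inj, eq_sub_iff_add_eq]
  split_ifs <;> linarith

lemma bhatt_typewriter (hq : 1 < q) (hε0 : 0 ≤ ε) (hε1 : ε ≤ 1) (k : ℕ) (x x' : Fin k → ZMod q) :
    bhatt (typewriter q ε) k x x' = ∏ i, cycleKernel q (alpha ε) (x i) (x' i) := by
  simp only [bhatt_eq_prod (typewriter_nonneg hε0 hε1), sum_sqrt_typewriter hq hε0 hε1]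

end Kernel

section Coset

variable {q : ℕ}

/-- Reduction modulo `2` on `ℤ/q` for even `q`; the zero-error code is its kernel in each
coordinate. -/
def parity (hq : 2 ∣ q) : ZMod q →+* ZMod 2 := ZMod.castHom hq (ZMod 2)

lemma cycleKernel_self (hq : 1 < q) (β : ℝ) (x : ZMod q) : cycleKernel q β x x = 1 := by
  have : Fact (1 < q) := ⟨hq⟩
  simp [cycleKernel, eq_sub_iff_add_eq]

variable [NeZero q] {n : ℕ} (C : Submodule (ZMod 2) (Fin n → ZMod 2))

lemma eq_zero_or_eq_one (b : ZMod 2) : b = 0 ∨ b = 1 := by decide +revert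

lemma val_parity (hq : 2 ∣ q) (x : ZMod q) : (parity hq x).val = x.val % 2 := by
  conv_lhs => rw [← ZMod.natCast_zmod_val x, map_natCast, ZMod.val_natCast]

lemma mem_cosetCode (hq : 2 ∣ q) (x : Fin n → ZMod q) :
    x ∈ cosetCode q C ↔ parity hq ∘ x ∈ C := by
  simp only [cosetCode, Finset.mem_filter_univ]
  constructor
  · rintro ⟨a, ha, b, hb, rfl⟩
    convert hb using 1
    ext i
    obtain ⟨j, -, hj⟩ := ha i
    rw [Function.comp_apply, Pi.add_apply, hj, liftWord, map_add, map_natCast, map_natCast,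
      Nat.cast_mul, ZMod.natCast_self, zero_mul, zero_add, ZMod.natCast_zmod_val]
  · intro hx
    refine ⟨x - liftWord q (parity hq ∘ x), fun i => ⟨(x i).val / 2,
      Nat.div_lt_div_of_lt_of_dvd hq (ZMod.val_lt _), ?_⟩, _, hx, (sub_add_cancel _ _).symm⟩
    rw [Pi.sub_apply, liftWord, Function.comp_apply, val_parity, sub_eq_iff_eq_add,
      ← Nat.cast_add, Nat.div_add_mod, ZMod.natCast_zmod_val]

lemma cosetCode_nonempty (hq : 2 ∣ q) : (cosetCode q C).Nonempty :=
  ⟨0, (mem_cosetCode C hq 0).2 (by convert C.zero_mem; ext; simp)⟩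

lemma card_cosetCode_mul (hq : 2 ∣ q) :
    (cosetCode q C).card * 2 ^ n = 2 ^ Module.finrank (ZMod 2) C * q ^ n := by
  set f : (Fin n → ZMod q) →+ (Fin n → ZMod 2) := (parity hq).toAddMonoidHom.compLeft (Fin n)
  have hf : Function.Surjective f := (ZMod.castHom_surjective hq).comp_left
  have hcode : Nat.card (C.toAddSubgroup.comap f) = (cosetCode q C).card :=
    Nat.subtype_card _ fun x => mem_cosetCode C hq x
  have hcomap := (C.toAddSubgroup.comap f).card_mul_index
  rw [AddSubgroup.index_comap_of_surjective C.toAddSubgroup hf, hcode, Nat.card_fun,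
    Nat.card_zmod, Nat.card_fin] at hcomap
  have hC : Nat.card C * C.toAddSubgroup.index = 2 ^ n :=
    C.toAddSubgroup.card_mul_index.trans (by simp)
  have hfinrank : Nat.card C = 2 ^ Module.finrank (ZMod 2) C := by
    rw [Module.natCard_eq_pow_finrank (K := ZMod 2), Nat.card_zmod]
  rw [← hcomap, ← hC, ← hfinrank]
  ring

lemma logb_card_cosetCode (hq : 2 ∣ q) (hn : 0 < n) :
    Real.logb 2 (cosetCode q C).card / n =
      (Module.finrank (ZMod 2) C : ℝ) / n + Real.logb 2 (q / 2) := by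
  have hn' : (n : ℝ) ≠ 0 := by exact_mod_cast hn.ne'
  have hq' : (q : ℝ) ≠ 0 := by exact_mod_cast NeZero.ne q
  have hcard : ((cosetCode q C).card : ℝ) = 2 ^ Module.finrank (ZMod 2) C * (q / 2) ^ n := by
    rw [div_pow, mul_div_assoc', eq_div_iff (by positivity)]
    exact_mod_cast card_cosetCode_mul C hq
  rw [hcard, Real.logb_mul (by positivity) (by positivity), Real.logb_pow, Real.logb_pow,
    Real.logb_self_eq_one one_lt_two]
  field_simp

lemma sum_cycleKernel_of_parity (hq : 2 ∣ q) (β : ℝ) (x : ZMod q) (b : ZMod 2) :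
    ∑ y with parity hq y = parity hq x + b, cycleKernel q β x y = if b = 0 then 1 else 2 * β := by
  have hone : (1 : ZMod 2) ≠ 0 := by decide
  simp only [cycleKernel, Matrix.of_apply, Finset.sum_add_distrib, Finset.sum_ite_eq',
    Finset.mem_filter_univ, map_add, map_one, sub_eq_add_neg, add_right_inj, left_eq_add]
  rcases eq_zero_or_eq_one b with rfl | rfl
  · simp [hone]
  · simp [hone, two_mul]

lemma sum_prod_cycleKernel_of_parity (hq : 2 ∣ q) (β : ℝ) (x : Fin n → ZMod q)
    (b : Fin n → ZMod 2) :
    ∑ y with parity hq ∘ y = parity hq ∘ x + b, ∏ i, cycleKernel q β (x i) (y i) =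
      (2 * β) ^ hammingNorm b := by
  have hfiber : (Finset.univ.filter fun y : Fin n → ZMod q => parity hq ∘ y = parity hq ∘ x + b) =
      Fintype.piFinset fun i =>
        Finset.univ.filter fun y : ZMod q => parity hq y = parity hq (x i) + b i := by
    ext y
    simp [funext_iff]
  rw [hfiber, ← Finset.prod_univ_sum]
  simp only [sum_cycleKernel_of_parity, prod_ite_eq_zero, one_pow, one_mul]

lemma sum_cosetCode_prod_cycleKernel (hq : 2 ∣ q) (β : ℝ) {x : Fin n → ZMod q}
    (hx : x ∈ cosetCode q C) :
    ∑ x' ∈ (cosetCode q C).erase x, ∏ i, cycleKernel q β (x i) (x' i) =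
      nonzeroSum (fun b => (2 * β) ^ hammingNorm b) C := by
  classical
  have hq1 : 1 < q := Nat.lt_of_lt_of_le one_lt_two (Nat.le_of_dvd (NeZero.pos q) hq)
  have hmaps : ∀ x' ∈ cosetCode q C,
      parity hq ∘ x' - parity hq ∘ x ∈ Finset.univ.filter fun b => b ∈ C := fun x' hx' =>
    Finset.mem_filter_univ _ |>.2 <|
      C.sub_mem ((mem_cosetCode C hq x').1 hx') ((mem_cosetCode C hq x).1 hx)
  have hfiber (b : Fin n → ZMod 2) (hb : b ∈ Finset.univ.filter fun b => b ∈ C) :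
      (cosetCode q C).filter (fun x' => parity hq ∘ x' - parity hq ∘ x = b) =
        Finset.univ.filter fun x' => parity hq ∘ x' = parity hq ∘ x + b := by
    ext x'
    simp only [Finset.mem_filter, Finset.mem_univ, true_and, sub_eq_iff_eq_add',
      and_iff_right_iff_imp]
    intro h
    rw [mem_cosetCode C hq, h]
    exact C.add_mem ((mem_cosetCode C hq x).1 hx) ((Finset.mem_filter.1 hb).2)
  rw [nonzeroSum_eq_sum_sub, Finset.sum_erase_eq_sub hx, ← Finset.sum_fiberwise_of_maps_to hmaps]
  simp only [cycleKernel_self hq1, Finset.prod_const_one, hammingNorm_zero, pow_zero]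
  congr 1
  refine (Finset.sum_congr rfl fun b hb => ?_).trans (by congr!)
  rw [hfiber b hb, sum_prod_cycleKernel_of_parity]

lemma maxError_cosetCode_le (hq : 2 ∣ q) {ε : ℝ} (hε0 : 0 ≤ ε) (hε1 : ε ≤ 1) :
    maxError (typewriter q ε) (fun x : {x // x ∈ cosetCode q C} => x.1) ≤
      nonzeroSum (fun b => (2 * alpha ε) ^ hammingNorm b) C := by
  have hq1 : 1 < q := Nat.lt_of_lt_of_le one_lt_two (Nat.le_of_dvd (NeZero.pos q) hq)
  have : Nonempty {x // x ∈ cosetCode q C} := (cosetCode_nonempty C hq).to_subtype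
  refine maxError_le_of_sum_bhatt_le (typewriter_nonneg hε0 hε1) fun x => le_of_eq ?_
  rw [← sum_cosetCode_prod_cycleKernel C hq (alpha ε) x.2, Finset.sum_erase_eq_sub x.2,
    Finset.sum_erase_eq_sub (Finset.mem_univ x)]
  simp only [bhatt_typewriter hq1 hε0 hε1]
  rw [Finset.sum_coe_sort (cosetCode q C) fun x' => ∏ i, cycleKernel q (alpha ε) (x.1 i) (x' i)]

lemma exists_cosetCode_expurgatedBSC_le (hq : 2 ∣ q) {ε r : ℝ} (hε0 : 0 < ε) (hε1 : ε < 1)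
    (h0 : 0 ≤ r) (h1 : r ≤ 1) :
    ∃ C : ∀ n : ℕ, Submodule (ZMod 2) (Fin n → ZMod 2),
      HasGVSpectrum r C ∧
      Tendsto (fun n : ℕ => (Module.finrank (ZMod 2) (C n) : ℝ) / n) atTop (𝓝 r) ∧
      Tendsto (fun n : ℕ => Real.logb 2 (cosetCode q (C n)).card / n) atTop
        (𝓝 (r + Real.logb 2 (q / 2))) ∧
      (expurgatedBSC ε r : EReal) ≤ liminf (fun n : ℕ => expo n (maxError (typewriter q ε)
        (fun x : {x // x ∈ cosetCode q (C n)} => x.1))) atTop := by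
  obtain ⟨C, hspec, hdim, hsum⟩ := exists_hasGVSpectrum hε0 hε1 h0 h1
  have hrate : Tendsto (fun n : ℕ => (Module.finrank (ZMod 2) (C n) : ℝ) / n) atTop (𝓝 r) := by
    simpa only [hdim] using tendsto_gvDim_div h0
  refine ⟨C, hspec, hrate, (hrate.add_const _).congr' ?_, le_liminf_expo
    (fun n => maxError_nonneg (typewriter_nonneg hε0.le hε1.le) _)
    fun n => (maxError_cosetCode_le (C n) hq hε0.le hε1.le).trans (hsum n)⟩
  filter_upwards [eventually_gt_atTop 0] with n hn
  exact (logb_card_cosetCode (C n) hq hn).symm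

lemma expurgatedBSC_le_reliabilityMax (hq : 2 ∣ q) {ε r : ℝ} (hε0 : 0 < ε) (hε1 : ε < 1)
    (h0 : 0 ≤ r) :
    (expurgatedBSC ε r : EReal) ≤ reliabilityMax (typewriter q ε) (r + Real.logb 2 (q / 2)) := by
  have hq1 : 1 < q := Nat.lt_of_lt_of_le one_lt_two (Nat.le_of_dvd (NeZero.pos q) hq)
  have hW := typewriter_nonneg (q := q) hε0.le hε1.le
  rcases le_or_gt 1 r with h1 | h1
  · exact (EReal.coe_nonpos.2 (expurgatedBSC_nonpos ε h1)).trans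
      (reliabilityMax_nonneg hW (sum_typewriter hq1 ε) _)
  refine EReal.ge_of_forall_gt_iff_ge.1 fun c hc => ?_
  have hrate : ∀ᶠ r' in 𝓝[>] r, r' ∈ Set.Ioo r 1 := Ioo_mem_nhdsGT h1
  obtain ⟨r', ⟨hr, hr1⟩, hc'⟩ := (hrate.and
    (lowerSemicontinuousWithinAt_expurgatedBSC ε h0 c (EReal.coe_lt_coe_iff.1 hc))).exists
  obtain ⟨C, -, -, hcard, hliminf⟩ :=
    exists_cosetCode_expurgatedBSC_le hq hε0 hε1 (h0.trans hr.le) hr1.le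
  have (n : ℕ) : Nonempty {x // x ∈ cosetCode q (C n)} := (cosetCode_nonempty (C n) hq).to_subtype
  exact (EReal.coe_le_coe_iff.2 hc'.le).trans (hliminf.trans
    (liminf_expo_maxError_le_reliabilityMax hW _ (add_lt_add_left hr _)
      (by simpa only [Fintype.card_coe] using hcard)))

end Coset

section PositiveSemidefinite

open Matrix

variable {A ι : Type*}

lemma posSemidef_prod (s : Finset ι) {M : ι → Matrix A A ℝ} (hM : ∀ i, (M i).PosSemidef) :
    (Matrix.of fun x y => ∏ i ∈ s, M i x y).PosSemidef := by
  classical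
  induction s using Finset.induction_on with
  | empty =>
    convert (PosSemidef.one (n := Unit) (R := ℝ)).submatrix fun _ : A => () using 1
    ext
    simp
  | insert i s hi ih =>
    simp only [Finset.prod_insert hi]
    exact (hM i).hadamard ih

variable [Fintype A] {M : Matrix A A ℝ} {s : ℝ}

-- Expand `⟨P - u, M (P - u)⟩ ≥ 0` for the uniform distribution `u`, an eigenvector of `M`.
lemma div_card_le_of_posSemidef (hM : M.PosSemidef) (hs : ∀ x, ∑ y, M x y = s) {P : A → ℝ}
    (hP : ∑ x, P x = 1) : s / Fintype.card A ≤ ∑ x, ∑ y, P x * P y * M x y := by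
  have hA : (Fintype.card A : ℝ) ≠ 0 := by
    rw [Nat.cast_ne_zero, ← Finset.card_univ, Finset.card_ne_zero]
    exact Finset.nonempty_of_sum_ne_zero (hP.trans_ne one_ne_zero)
  have hone : M *ᵥ 1 = s • 1 := by
    ext x
    simp [mulVec, dotProduct, hs]
  have hsymm (v : A → ℝ) : (1 : A → ℝ) ⬝ᵥ M *ᵥ v = s * ∑ x, v x := by
    rw [dotProduct_mulVec, ← mulVec_transpose, ← conjTranspose_eq_transpose_of_trivial,
      hM.isHermitian.eq, hone, smul_dotProduct, one_dotProduct, smul_eq_mul]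
  have hform : P ⬝ᵥ M *ᵥ P = ∑ x, ∑ y, P x * P y * M x y := by
    simp only [dotProduct, mulVec, Finset.mul_sum]
    exact Finset.sum_congr rfl fun x _ => Finset.sum_congr rfl fun y _ => by ring
  have hnonneg := hM.dotProduct_mulVec_nonneg (P - (Fintype.card A : ℝ)⁻¹ • 1)
  simp only [star_trivial, mulVec_sub, mulVec_smul, hone, sub_dotProduct, dotProduct_sub,
    smul_dotProduct, dotProduct_smul, dotProduct_one, hsymm, hform, hP, smul_eq_mul, Pi.sub_apply,
    Pi.smul_apply, Pi.one_apply, Finset.sum_sub_distrib, Finset.sum_const, Finset.card_univ,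
    nsmul_eq_mul, mul_one] at hnonneg
  have hcancel : (Fintype.card A : ℝ)⁻¹ * (s * Fintype.card A) = s := by field_simp
  linear_combination hnonneg + (Fintype.card A : ℝ)⁻¹ * hcancel

end PositiveSemidefinite

section Expurgated

variable {q : ℕ} {β : ℝ}

lemma cycleKernel_le_rpow (hq : 2 < q) {a s : ℝ} (hs : 0 < s) (hβ : β ≤ a ^ s) (x y : ZMod q) :
    cycleKernel q β x y ≤ cycleKernel q a x y ^ s := by
  have : Fact (2 < q) := ⟨hq⟩
  have : Fact (1 < q) := ⟨by lia⟩
  have hne : x + 1 ≠ x - 1 := fun h => ZMod.neg_one_ne_one (n := q) (by linear_combination -h)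
  by_cases h0 : y = x
  · simp [cycleKernel, h0, eq_sub_iff_add_eq]
  by_cases h1 : y = x + 1
  · simpa [cycleKernel, h1, hne] using hβ
  by_cases h2 : y = x - 1
  · simpa [cycleKernel, h2, hne.symm, sub_eq_iff_eq_add] using hβ
  · simp [cycleKernel, h0, h1, h2, Real.zero_rpow hs.ne']

variable [NeZero q]

-- With `B` the incidence matrix of the `q`-cycle, the kernel is `(1 - 2β) I + β B Bᵀ`.
lemma posSemidef_cycleKernel (h0 : 0 ≤ β) (h1 : β ≤ 1 / 2) : (cycleKernel q β).PosSemidef := by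
  let B : Matrix (ZMod q) (ZMod q) ℝ :=
    Matrix.of fun x t => (if t = x then 1 else 0) + (if t = x + 1 then 1 else 0)
  have hB : cycleKernel q β = (1 - 2 * β) • (1 : Matrix _ _ ℝ) + β • (B * B.conjTranspose) := by
    ext x y
    simp only [cycleKernel, B, Matrix.of_apply, Matrix.add_apply, Matrix.smul_apply,
      Matrix.mul_apply, Matrix.conjTranspose_apply, star_trivial, Matrix.one_apply, smul_eq_mul,
      mul_add, mul_ite, mul_one, mul_zero, Finset.sum_add_distrib, Finset.sum_ite_eq',
      Finset.mem_univ, if_true, add_left_inj, eq_sub_iff_add_eq, eq_comm (a := x)]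
    split_ifs <;> ring
  rw [hB]
  exact (Matrix.PosSemidef.one.smul (by linarith)).add
    ((Matrix.posSemidef_self_mul_conjTranspose B).smul h0)

lemma sum_cycleKernel (β : ℝ) (x : ZMod q) : ∑ y, cycleKernel q β x y = 1 + 2 * β := by
  simp [cycleKernel, Finset.sum_add_distrib, two_mul, add_assoc]

lemma pow_le_sum_prod_cycleKernel (h0 : 0 ≤ β) (h1 : β ≤ 1 / 2) {k : ℕ}
    {P : (Fin k → ZMod q) → ℝ} (hP : ∑ x, P x = 1) :
    ((1 + 2 * β) / q) ^ k ≤ ∑ x, ∑ y, P x * P y * ∏ i, cycleKernel q β (x i) (y i) := by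
  have hpsd := posSemidef_prod (A := Fin k → ZMod q) Finset.univ fun i =>
    (posSemidef_cycleKernel (q := q) h0 h1).submatrix fun x => x i
  have hrow (x : Fin k → ZMod q) :
      ∑ y : Fin k → ZMod q, ∏ i, cycleKernel q β (x i) (y i) = (1 + 2 * β) ^ k := by
    simp only [← Fintype.prod_sum, sum_cycleKernel, Finset.prod_const, Finset.card_univ,
      Fintype.card_fin]
  simpa [div_pow] using div_card_le_of_posSemidef hpsd hrow hP

variable {ε ρ : ℝ}

lemma pow_le_quadForm_typewriter (hq : 2 < q) (hε0 : 0 ≤ ε) (hε1 : ε ≤ 1) (hρ : 0 < ρ)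
    (h0 : 0 ≤ β) (h1 : β ≤ 1 / 2) (hβ : β ≤ alpha ε ^ (1 / ρ)) {k : ℕ}
    {P : (Fin k → ZMod q) → ℝ} (hP : P ∈ stdSimplex ℝ (Fin k → ZMod q)) :
    ((1 + 2 * β) / q) ^ k ≤ quadForm (typewriter q ε) k ρ P := by
  refine (pow_le_sum_prod_cycleKernel h0 h1 hP.2).trans ?_
  refine Finset.sum_le_sum fun x _ => Finset.sum_le_sum fun y _ => ?_
  refine mul_le_mul_of_nonneg_left ?_ (mul_nonneg (hP.1 x) (hP.1 y))
  rw [bhatt_typewriter (by lia) hε0 hε1,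
    ← Real.finsetProd_rpow _ _ fun i _ => cycleKernel_nonneg (alpha_nonneg ε) _ _]
  exact Finset.prod_le_prod (fun i _ => cycleKernel_nonneg h0 _ _)
    fun i _ => cycleKernel_le_rpow hq (one_div_pos.2 hρ) hβ _ _

lemma expurgatedX_typewriter_le (hq : 2 < q) (hε0 : 0 ≤ ε) (hε1 : ε ≤ 1) (hρ : 0 < ρ)
    (h0 : 0 ≤ β) (h1 : β ≤ 1 / 2) (hβ : β ≤ alpha ε ^ (1 / ρ)) {k : ℕ} (hk : k ≠ 0) :
    expurgatedX (typewriter q ε) k ρ ≤ ρ * (Real.logb 2 q - Real.logb 2 (1 + 2 * β)) := by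
  have hq' : (0 : ℝ) < q := by exact_mod_cast NeZero.pos q
  have hinf : ((1 + 2 * β) / q) ^ k ≤
      sInf (quadForm (typewriter q ε) k ρ '' stdSimplex ℝ (Fin k → ZMod q)) := by
    refine le_csInf (Set.Nonempty.image _ ⟨_, single_mem_stdSimplex ℝ 0⟩) ?_
    rintro _ ⟨P, hP, rfl⟩
    exact pow_le_quadForm_typewriter hq hε0 hε1 hρ h0 h1 hβ hP
  calc expurgatedX (typewriter q ε) k ρ
      ≤ -(ρ / k) * Real.logb 2 (((1 + 2 * β) / q) ^ k) :=
        mul_le_mul_of_nonpos_left (Real.logb_le_logb_of_le one_lt_two (by positivity) hinf)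
          (neg_nonpos.2 (by positivity))
    _ = ρ * (Real.logb 2 q - Real.logb 2 (1 + 2 * β)) := by
        rw [Real.logb_pow, Real.logb_div (by positivity) hq'.ne']
        field_simp
        ring

lemma expurgatedInf_typewriter_lt (hq : 2 < q) (hε0 : 0 < ε) (hε1 : ε < 1) (hne : ε ≠ 1 / 2)
    {r : ℝ} (h0 : 0 ≤ r) (hr : r < rateExBSC ε) :
    expurgatedInf (typewriter q ε) (r + Real.logb 2 (q / 2)) < (expurgatedBSC ε r : EReal) := by
  obtain ⟨B, hB, hle⟩ := exists_lt_expurgatedBSC hε0 hε1 hne h0 hr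
  refine lt_of_le_of_lt ?_ (EReal.coe_lt_coe_iff.2 hB)
  refine iSup_le fun ⟨k, hk⟩ => iSup_le fun ⟨ρ, hρ⟩ => EReal.coe_le_coe_iff.2 ?_
  obtain ⟨β, ⟨hβ0, hβ1⟩, hβα, hβB⟩ := hle ρ hρ
  have hX := expurgatedX_typewriter_le hq hε0.le hε1.le (one_pos.trans_le hρ) hβ0 hβ1 hβα
    (Nat.one_le_iff_ne_zero.1 hk)
  rw [logb_div_two (NeZero.ne (q : ℝ))]
  linarith

lemma logb_lt_rateCrit (hε0 : 0 < ε) (hne : ε ≠ 1 / 2) :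
    Real.logb 2 (q / 2) < rateCrit q ε := by
  have hsqrt : Real.sqrt ε ≠ Real.sqrt (1 - ε) := fun h => hne <| by
    have := Real.sqrt_pos.2 hε0
    have := Real.sqrt_pos.1 (h ▸ this)
    linarith [(Real.sqrt_inj hε0.le this.le).1 h]
  have hpos : 0 < Real.sqrt ε + Real.sqrt (1 - ε) :=
    add_pos_of_pos_of_nonneg (Real.sqrt_pos.2 hε0) (Real.sqrt_nonneg _)
  have hh2 : h2 (Real.sqrt ε / (Real.sqrt ε + Real.sqrt (1 - ε))) < 1 := h2_lt_one fun h => by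
    rw [div_eq_div_iff hpos.ne' two_ne_zero] at h
    exact hsqrt (by linarith)
  rw [rateCrit, logb_div_two (NeZero.ne (q : ℝ))]
  linarith

end Expurgated

end Typewriter

end

theorem theorem2_general (q : ℕ) [NeZero q] (heven : Even q)
    (ε : ℝ) (hε0 : 0 < ε) (hε1 : ε < 1) :
    (∀ R : ℝ, Real.logb 2 (q / 2) ≤ R →
      (Typewriter.expurgatedBSC ε (R - Real.logb 2 (q / 2)) : EReal) ≤
          Typewriter.reliabilityAvg (Typewriter.typewriter q ε) R ∧
      (Typewriter.expurgatedBSC ε (R - Real.logb 2 (q / 2)) : EReal) ≤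
          Typewriter.reliabilityMax (Typewriter.typewriter q ε) R) ∧
    (∀ R : ℝ, Real.logb 2 (q / 2) ≤ R → R ≤ Real.logb 2 q →
      ∃ C₂ : ∀ n : ℕ, Submodule (ZMod 2) (Fin n → ZMod 2),
        Typewriter.HasGVSpectrum (R - Real.logb 2 (q / 2)) C₂ ∧
        Tendsto (fun n : ℕ => (Module.finrank (ZMod 2) (C₂ n) : ℝ) / n) atTop
          (𝓝 (R - Real.logb 2 (q / 2))) ∧
        Tendsto (fun n : ℕ => Real.logb 2 (Typewriter.cosetCode q (C₂ n)).card / n) atTop (𝓝 R) ∧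
        (Typewriter.expurgatedBSC ε (R - Real.logb 2 (q / 2)) : EReal) ≤
          liminf (fun n : ℕ => Typewriter.expo n
            (Typewriter.maxError (Typewriter.typewriter q ε)
              (fun x : {x // x ∈ Typewriter.cosetCode q (C₂ n)} => x.1))) atTop) ∧
    (2 < q → ε ≠ 1 / 2 →
      0 < Typewriter.rateExBSC ε ∧
      (∀ R : ℝ, Real.logb 2 (q / 2) ≤ R → R < Real.logb 2 (q / 2) + Typewriter.rateExBSC ε →
        Typewriter.expurgatedInf (Typewriter.typewriter q ε) R <
          (Typewriter.expurgatedBSC ε (R - Real.logb 2 (q / 2)) : EReal)) ∧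
      ¬ (∀ R : ℝ, 0 < R → R < Typewriter.rateCrit q ε →
          Typewriter.reliabilityAvg (Typewriter.typewriter q ε) R =
            Typewriter.expurgatedInf (Typewriter.typewriter q ε) R) ∧
      ¬ (∀ R : ℝ, 0 < R → R < Typewriter.rateCrit q ε →
          Typewriter.reliabilityMax (Typewriter.typewriter q ε) R =
            Typewriter.expurgatedInf (Typewriter.typewriter q ε) R)) := by
  have hdvd := heven.two_dvd
  have hmax (R : ℝ) (hR : Real.logb 2 (q / 2) ≤ R) := by
    simpa only [sub_add_cancel] using
      Typewriter.expurgatedBSC_le_reliabilityMax hdvd hε0 hε1 (sub_nonneg.2 hR)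
  have havg (R : ℝ) (hR : Real.logb 2 (q / 2) ≤ R) := (hmax R hR).trans
    (Typewriter.reliabilityMax_le_reliabilityAvg (Typewriter.typewriter_nonneg hε0.le hε1.le) R)
  refine ⟨fun R hR => ⟨havg R hR, hmax R hR⟩, fun R hR hRq => ?_, fun hq hne => ?_⟩
  · have hlog := Typewriter.logb_div_two (NeZero.ne (q : ℝ))
    simpa only [sub_add_cancel] using Typewriter.exists_cosetCode_expurgatedBSC_le hdvd hε0 hε1
      (sub_nonneg.2 hR) (by linarith)
  have hpos := Typewriter.rateExBSC_pos hne
  have hlt (R : ℝ) (hR : Real.logb 2 (q / 2) ≤ R)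
      (hR' : R < Real.logb 2 (q / 2) + Typewriter.rateExBSC ε) := by
    simpa only [sub_add_cancel] using Typewriter.expurgatedInf_typewriter_lt hq hε0 hε1 hne
      (sub_nonneg.2 hR) (sub_lt_iff_lt_add'.2 hR')
  obtain ⟨R, hR, hR'⟩ := exists_between
    (lt_min (lt_add_of_pos_right _ hpos) (Typewriter.logb_lt_rateCrit (q := q) hε0 hne))
  obtain ⟨hRex, hRcrit⟩ := lt_min_iff.1 hR'
  have hR0 : 0 < R := (Real.logb_nonneg one_lt_two
    ((one_le_div two_pos).2 (by exact_mod_cast hq.le))).trans_lt hR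
  exact ⟨hpos, hlt,
    fun h => ((hlt R hR.le hRex).trans_le (havg R hR.le)).ne' (h R hR0 hRcrit),
    fun h => ((hlt R hR.le hRex).trans_le (hmax R hR.le)).ne' (h R hR0 hRcrit)⟩

theorem theorem2 (q : ℕ) [NeZero q] (hq : 4 ≤ q) (heven : Even q)
    (ε : ℝ) (hε0 : 0 < ε) (hε : ε ≤ 1 / 2) :
    -- the lower bound on the reliability function
    (∀ R : ℝ, Real.logb 2 (q / 2) < R →
      (Typewriter.expurgatedBSC ε (R - Real.logb 2 (q / 2)) : EReal) ≤
          Typewriter.reliabilityAvg (Typewriter.typewriter q ε) R ∧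
      (Typewriter.expurgatedBSC ε (R - Real.logb 2 (q / 2)) : EReal) ≤
          Typewriter.reliabilityMax (Typewriter.typewriter q ε) R) ∧
    -- it is attained by unions of cosets of the zero-error code
    (∀ R : ℝ, Real.logb 2 (q / 2) < R → R ≤ Real.logb 2 q →
      ∃ C₂ : ∀ n : ℕ, Submodule (ZMod 2) (Fin n → ZMod 2),
        Typewriter.HasGVSpectrum (R - Real.logb 2 (q / 2)) C₂ ∧
        Tendsto (fun n : ℕ => (Module.finrank (ZMod 2) (C₂ n) : ℝ) / n) atTop
          (𝓝 (R - Real.logb 2 (q / 2))) ∧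
        Tendsto (fun n : ℕ => Real.logb 2 (Typewriter.cosetCode q (C₂ n)).card / n) atTop (𝓝 R) ∧
        (Typewriter.expurgatedBSC ε (R - Real.logb 2 (q / 2)) : EReal) ≤
          liminf (fun n : ℕ => Typewriter.expo n
            (Typewriter.maxError (Typewriter.typewriter q ε)
              (fun x : {x // x ∈ Typewriter.cosetCode q (C₂ n)} => x.1))) atTop) ∧
    -- it beats the multiletter expurgated bound and refutes its tightness below the critical rate
    (ε < 1 / 2 →
      0 < Typewriter.rateExBSC ε ∧
      (∀ R : ℝ, Real.logb 2 (q / 2) < R → R < Real.logb 2 (q / 2) + Typewriter.rateExBSC ε →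
        Typewriter.expurgatedInf (Typewriter.typewriter q ε) R <
          (Typewriter.expurgatedBSC ε (R - Real.logb 2 (q / 2)) : EReal)) ∧
      ¬ (∀ R : ℝ, 0 < R → R < Typewriter.rateCrit q ε →
          Typewriter.reliabilityAvg (Typewriter.typewriter q ε) R =
            Typewriter.expurgatedInf (Typewriter.typewriter q ε) R) ∧
      ¬ (∀ R : ℝ, 0 < R → R < Typewriter.rateCrit q ε →
          Typewriter.reliabilityMax (Typewriter.typewriter q ε) R =
            Typewriter.expurgatedInf (Typewriter.typewriter q ε) R)) := by
  obtain ⟨hrel, hcoset, hex⟩ := theorem2_general q heven ε hε0 (by linarith)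
  exact ⟨fun R hR => hrel R hR.le, fun R hR => hcoset R hR.le, fun hε' =>
    (hex (by lia) hε'.ne).imp_right (And.imp_left fun h R hR => h R hR.le)⟩
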